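/- Let $n\ge 1$ and $0\le k\le n-1$, let $\rho=(n-k,1^k)\vdash n$ be a hook, and let $\ell\in\{1,n-k\}$ be a part of $\rho$. Then for every integer $m\ge 0$ $$\sum_{\substack{\lambda\vdash n,\ m(\lambda)=m,\\ i\in\lambda}}\frac{|\mathcal C_{\lambda,i}|}{d_{\ell_-(\rho)}}\,\gamma^{\rho,\ell}_{\lambda,i}=[t^m]\; n!\binom{t+n-k-1}{n},$$ where $\binom{x}{n}=x(x-1)\cdots(x-n+1)/n!$ is regarded as a polynomial. Here $m(\lambda)$ is the number of parts of $\lambda$; the sum runs over the partitions $\lambda$ of $n$ with $m$ parts and over the distinct parts $i$ of $\lambda$; $\mathcal C_{\lambda,i}\subset\mathfrak S_n$ is the set of permutations of cycle type $\lambda$ in which $n$ lies on a cycle of length $i$, and $K_{\lambda,i}=\sum_{\pi\in\mathcal C_{\lambda,i}}\pi\in\mathbb C[\mathfrak S_n]$; $d_\mu$ is the number of standard Young tableaux of shape $\mu$; $\ell_-(\rho)$ is the partition of $n-1$ obtained from $\rho$ by replacing one part $\ell$ by $\ell-1$ (deleting it if $\ell=1$). The generalized characters are $$\gamma^{\mu,j}_{\lambda,i}=\frac{n!}{d_\mu}\,[K_{\lambda,i}]\,\Gamma^{\mu,j},\qquad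 \Gamma^{\mu,j}=\sum_{T\in\mathrm{SYT}_{\mu,j}}e_T,$$ where $\mathrm{SYT}_{\mu,j}$ is the set of standard Young tableaux of shape $\mu$ in which $n$ stands at the end of a row of length $j$; $[K_{\lambda,i}]$ is the coefficient with respect to the basis $\{K_{\lambda,i}\}_{\lambda\vdash n,\,i\in\lambda}$ of the centralizer of $\mathfrak S_{n-1}$ in $\mathbb C[\mathfrak S_n]$, to which $\Gamma^{\mu,j}$ belongs; and $e_T$ is Young's semi-normal unit, defined recursively by $e_T=1$ for the empty tableau and $$e_T=\frac{d_\mu}{n!}\,e_{T^*}P_TN_Te_{T^*}$$ for $T$ of shape $\mu\vdash n$, $n\ge1$, where $T^*$ is $T$ with the box of the label $n$ deleted, $e_{T^*}\in\mathbb C[\mathfrak S_{n-1}]\subset\mathbb C[\mathfrak S_n]$, $P_T$ is the sum of the permutations that preserve the rows of $T$, and $N_T$ is the signed sum of those that preserve the columns of $T$. -/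

import Mathlib

noncomputable section

namespace NearCentral

/-- The group algebra `ℂ[𝔖ₙ]`. The labels `1, …, n` are the elements `0, …, n - 1` of `Fin n`. -/
abbrev GroupAlg (n : ℕ) : Type := MonoidAlgebra ℂ (Equiv.Perm (Fin n))

/-- The Ferrers diagram of a partition: its rows are the parts in weakly decreasing order.
A box is a pair (row, column), both counted from `0`. -/
def ferrers {n : ℕ} (lam : n.Partition) : YoungDiagram :=
  YoungDiagram.ofRowLens (lam.parts.sort (· ≥ ·)) (lam.parts.pairwise_sort (· ≥ ·)).sortedGE

/-- Standard Young tableaux of shape `μ` with `n` labels: `box a` is the box that holds the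
label `a`; this is a bijection from the labels to the boxes of `μ`, and labels increase to the
right along rows and down columns. -/
@[ext]
structure SYT (n : ℕ) (μ : YoungDiagram) where
  box : Fin n → ℕ × ℕ
  box_injective : Function.Injective box
  mem_iff : ∀ c : ℕ × ℕ, c ∈ μ ↔ ∃ a, box a = c
  row_lt : ∀ a b, (box a).1 = (box b).1 → (box a).2 < (box b).2 → a < b
  col_lt : ∀ a b, (box a).2 = (box b).2 → (box a).1 < (box b).1 → a < b

instance SYT.instFinite (n : ℕ) (μ : YoungDiagram) : Finite (SYT n μ) := by
  refine Finite.of_injective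
    (fun T : SYT n μ => fun a : Fin n => (⟨T.box a, (T.mem_iff _).2 ⟨a, rfl⟩⟩ : μ.cells)) ?_
  intro T S h
  refine SYT.ext (funext fun a => ?_)
  exact congrArg Subtype.val (congrFun h a)

instance SYT.instFintype (n : ℕ) (μ : YoungDiagram) : Fintype (SYT n μ) := Fintype.ofFinite _

/-- `d_μ`, the number of standard Young tableaux of shape `μ`. -/
def numSYT (μ : YoungDiagram) : ℕ := Nat.card (SYT μ.card μ)

/-- `d_λ` for a partition `λ`. -/
def degree {n : ℕ} (lam : n.Partition) : ℕ := numSYT (ferrers lam)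

/-- The shape of `T*`: the boxes of all labels but the largest one. -/
def SYT.deleteShape {n : ℕ} {μ : YoungDiagram} (T : SYT (n + 1) μ) : YoungDiagram where
  cells := Finset.univ.image fun a : Fin n => T.box a.castSucc
  isLowerSet := by
    intro c d hdc hc
    simp only [Finset.coe_image, Finset.coe_univ, Set.image_univ, Set.mem_range] at hc ⊢
    obtain ⟨a, rfl⟩ := hc
    have hle := Prod.le_def.1 hdc
    have ha : T.box a.castSucc ∈ μ := (T.mem_iff _).2 ⟨_, rfl⟩
    obtain ⟨b, hb⟩ := (T.mem_iff d).1 (μ.isLowerSet hdc ha)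
    have hmid : (d.1, (T.box a.castSucc).2) ≤ T.box a.castSucc := Prod.le_def.2 ⟨hle.1, le_rfl⟩
    obtain ⟨e, he⟩ := (T.mem_iff _).1 (μ.isLowerSet hmid ha)
    have hbe : b ≤ e := by
      rcases hle.2.lt_or_eq with h | h
      · exact (T.row_lt b e (by rw [hb, he]) (by rw [hb, he]; exact h)).le
      · exact (T.box_injective (by rw [hb, he]; exact Prod.ext rfl h)).le
    have hea : e ≤ a.castSucc := by
      rcases hle.1.lt_or_eq with h | h
      · exact (T.col_lt e a.castSucc (by rw [he]) (by rw [he]; exact h)).le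
      · exact (T.box_injective (by rw [he]; exact Prod.ext h rfl)).le
    have hlast : b ≠ Fin.last n := ((hbe.trans hea).trans_lt (Fin.castSucc_lt_last a)).ne
    exact ⟨b.castPred hlast, by rw [Fin.castSucc_castPred, hb]⟩

/-- `T*`: the tableau obtained from `T` by deleting the box with the largest label. -/
def SYT.delete {n : ℕ} {μ : YoungDiagram} (T : SYT (n + 1) μ) : SYT n T.deleteShape where
  box a := T.box a.castSucc
  box_injective := T.box_injective.comp (Fin.castSucc_injective n)
  mem_iff c := by
    rw [← YoungDiagram.mem_cells]
    simp [SYT.deleteShape]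
  row_lt a b h h' := Fin.castSucc_lt_castSucc_iff.1 (T.row_lt _ _ h h')
  col_lt a b h h' := Fin.castSucc_lt_castSucc_iff.1 (T.col_lt _ _ h h')

open Classical in
/-- The sum of all permutations that preserve every row of `T`. -/
def SYT.rowSum {n : ℕ} {μ : YoungDiagram} (T : SYT n μ) : GroupAlg n :=
  ∑ π : Equiv.Perm (Fin n) with ∀ a, (T.box (π a)).1 = (T.box a).1, MonoidAlgebra.single π 1

open Classical in
/-- The signed sum of all permutations that preserve every column of `T`. -/
def SYT.colSum {n : ℕ} {μ : YoungDiagram} (T : SYT n μ) : GroupAlg n :=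
  ∑ π : Equiv.Perm (Fin n) with ∀ a, (T.box (π a)).2 = (T.box a).2,
    MonoidAlgebra.single π ((Equiv.Perm.sign π : ℤ) : ℂ)

/-- The inclusion `ℂ[𝔖ₙ] → ℂ[𝔖ₙ₊₁]` that comes from letting `𝔖ₙ` fix the largest label. -/
def inclusion (n : ℕ) : GroupAlg n →+* GroupAlg (n + 1) :=
  MonoidAlgebra.mapDomainRingHom ℂ
    (Equiv.Perm.viaEmbeddingHom (Fin.castSuccEmb (n := n)))

/-- Young's semi-normal units, by the classical recursion: with `T*` the tableau `T` without its
largest label, `P_T` the row symmetrizer and `N_T` the column antisymmetrizer of `T`,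
`e_T = (d_μ / n!) e_{T*} P_T N_T e_{T*}`, and the unit of the empty tableau is `1`. -/
def SYT.unit : {n : ℕ} → {μ : YoungDiagram} → SYT n μ → GroupAlg n
  | 0, _, _ => 1
  | n + 1, μ, T =>
      ((numSYT μ : ℂ) / ((n + 1).factorial : ℂ)) •
        (inclusion n (SYT.unit T.delete) * T.rowSum * T.colSum * inclusion n (SYT.unit T.delete))

/-- `T` belongs to `SYT_{λ,i}`: the largest label stands at the end of a row of length `i`. -/
def SYT.LastInRow {n : ℕ} {μ : YoungDiagram} (T : SYT n μ) (i : ℕ) : Prop :=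
  ∃ a : Fin n, (a : ℕ) + 1 = n ∧ μ.rowLen (T.box a).1 = i ∧ (T.box a).2 + 1 = i

open Classical in
/-- `Γ^{λ,i}`, the sum of the semi-normal units `e_T` over `T ∈ SYT_{λ,i}`. -/
def Gam {n : ℕ} (lam : n.Partition) (i : ℕ) : GroupAlg n :=
  ∑ T : SYT n (ferrers lam) with T.LastInRow i, T.unit

open Classical in
/-- `𝒞_{λ,i}`: the permutations of cycle type `λ` (fixed points counted as parts `1`) whose
largest label lies on a cycle of length `i`. -/
def cls {n : ℕ} (lam : n.Partition) (i : ℕ) : Finset (Equiv.Perm (Fin n)) :=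
  {π | π.partition.parts = lam.parts ∧
    ∃ a : Fin n, (a : ℕ) + 1 = n ∧ Function.minimalPeriod π a = i}

/-- `K_{λ,i}`, the sum of the elements of `𝒞_{λ,i}`. -/
def K {n : ℕ} (lam : n.Partition) (i : ℕ) : GroupAlg n :=
  ∑ π ∈ cls lam i, MonoidAlgebra.single π 1

/-- `c` is a system of coordinates of `x` with respect to the elements `K_{μ,j}`, `μ ⊢ n`,
`j ∈ μ`, which form a basis of the centralizer of `𝔖ₙ₋₁` in `ℂ[𝔖ₙ]`. -/
def IsCoord {n : ℕ} (x : GroupAlg n) (c : n.Partition → ℕ → ℂ) : Prop :=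
  x = ∑ mu : n.Partition, ∑ j ∈ mu.parts.toFinset, c mu j • K mu j

open Classical in
/-- The coefficient `[K_{μ,j}] x` of `K_{μ,j}` (`j ∈ μ`) in an element `x` of that centralizer;
`0` by convention if `x` is not a linear combination of the `K_{μ,j}`. -/
def coeffK {n : ℕ} (mu : n.Partition) (j : ℕ) (x : GroupAlg n) : ℂ :=
  if h : ∃ c, IsCoord x c then h.choose mu j else 0

/-- The generalized character `γ^{λ,i}_{μ,j} = (n! / d_λ) [K_{μ,j}] Γ^{λ,i}`. -/
def genChar {n : ℕ} (lam : n.Partition) (i : ℕ) (mu : n.Partition) (j : ℕ) : ℂ :=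
  ((n.factorial : ℂ) / (degree lam : ℂ)) * coeffK mu j (Gam lam i)

/-- `i_-(λ)`: the partition obtained from `λ` by replacing one part `i` by `i - 1` (by nothing
if `i = 1`). -/
def lower {n : ℕ} (lam : n.Partition) (i : ℕ) (hi : i ∈ lam.parts) : (n - 1).Partition :=
  Nat.Partition.ofSums (n - 1) ((i - 1) ::ₘ lam.parts.erase i) (by
    have h := Multiset.sum_erase hi
    have hp := lam.parts_pos hi
    rw [lam.parts_sum] at h
    rw [Multiset.sum_cons]
    omega)

/-- The hook partition `(n - k, 1^k)` of `n`, for `0 ≤ k ≤ n - 1`. -/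
def hook (n k : ℕ) (hk : k < n) : n.Partition where
  parts := (n - k) ::ₘ Multiset.replicate k 1
  parts_pos := by
    intro i hi
    rcases Multiset.mem_cons.1 hi with rfl | hi
    · omega
    · rw [Multiset.eq_of_mem_replicate hi]; exact one_pos
  parts_sum := by
    rw [Multiset.sum_cons, Multiset.sum_replicate, smul_eq_mul, mul_one]
    omega

end NearCentral

end

/-!
The weighted sum of the generalized characters over the classes `𝒞_{λ,i}` with `m` parts is, up to
the factor `n! / (d_ρ d_{ℓ₋(ρ)})`, the sum of the coefficients of `Γ^{ρ,ℓ}` at the permutations with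
`m` cycles. Two facts have to be established.

*The coefficients of `Γ` are constant on each `𝒞_{λ,i}`.* Let `X_T = P_T N_T`. For a hook `T` the
compression `X_T x X_T` is a multiple of `X_T` (`IsCross.sandwich`) and `X_T² = (n! / d_μ) X_T`
(`IsCross.mul_self` with `SYT.factorial_mul_numSYT`), so that by induction the units `e_T` are
idempotents with identity coefficient `d_μ / n!` (`SYT.unit_spec`). Units of different hook tableaux
are orthogonal, because the sum of all transpositions is central and acts on the symmetrizers of
hooks of one size by different scalars (`SYT.unit_mul_unit_of_ne`). Averaging the conjugates of
`X_T` gives a central idempotent `z_μ` with the same identity coefficient as `∑ e_T`, summed over all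
`T` of shape `μ`; the difference of the two is an idempotent of trace zero, hence zero
(`SYT.sum_unit`). It follows that `Γ` is the product of `z_μ` and of the central idempotent of the
smaller shape in the smaller group algebra, so that it commutes with the latter
(`SYT.sum_lastInRow_comm`), while each `𝒞_{λ,i}` is one orbit under conjugation by the permutations
that fix the last label (`exists_conj_fixing`).

*The cycle numbers are distributed like the contents.* By Jucys' factorization the element
`∑ t ^ c(π) π` is the product of the factors `t + J_k` with the Jucys–Murphy elements `J_k`
(`cycleSum_succ`), and `J_k` acts on `e_T` by the content of the label `k`
(`SYT.jucysMurphy_mul_unit`). Therefore `∑ t ^ c(π) [π] e_T` is `d_ρ / n!` times the product of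
`t + c` over the contents `c` of `ρ`, which for the hook `(n - k, 1^k)` is
`(t + n - k - 1) ⋯ (t - k)`. As `Γ` is a sum of `d_{ℓ₋(ρ)}` units
(`card_lastInRow_hookDiagram`), the prefactor cancels.
-/

noncomputable section

namespace NearCentral

/-! ### Traces and idempotents in a group algebra -/

section GroupAlgebra

variable {G : Type*} [Group G]

/-- The coefficient of the identity, a trace on the group algebra. -/
def tr : MonoidAlgebra ℂ G →ₗ[ℂ] ℂ where
  toFun x := x.coeff 1
  map_add' _ _ := rfl
  map_smul' _ _ := rfl

lemma tr_apply (x : MonoidAlgebra ℂ G) : tr x = x.coeff 1 := rfl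

lemma tr_single (g : G) (c : ℂ) [Decidable (g = 1)] :
    tr (MonoidAlgebra.single g c) = if g = 1 then c else 0 := by
  classical
  simp [tr_apply, Finsupp.single_apply]

lemma tr_mul_single (x : MonoidAlgebra ℂ G) (g : G) (c : ℂ) :
    tr (x * MonoidAlgebra.single g c) = x.coeff g⁻¹ * c := by
  simp [tr_apply, MonoidAlgebra.coeff_mul_single_apply]

lemma tr_single_mul (x : MonoidAlgebra ℂ G) (g : G) (c : ℂ) :
    tr (MonoidAlgebra.single g c * x) = c * x.coeff g⁻¹ := by
  simp [tr_apply, MonoidAlgebra.coeff_single_mul_apply]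

lemma tr_mul_comm (x y : MonoidAlgebra ℂ G) : tr (x * y) = tr (y * x) := by
  induction y using MonoidAlgebra.induction_linear with
  | zero => simp
  | add y z hy hz => rw [mul_add, add_mul, map_add, map_add, hy, hz]
  | single g c => rw [tr_mul_single, tr_single_mul, mul_comm]

variable [Fintype G]

lemma eq_sum_single (x : MonoidAlgebra ℂ G) :
    x = ∑ g, x.coeff g • MonoidAlgebra.single g (1 : ℂ) := by
  classical
  ext g
  simp [MonoidAlgebra.coeff_sum]

/-- A linear combination of group elements commutes with everything as soon as it is
invariant under conjugation. -/
lemma commute_of_forall_single {x : MonoidAlgebra ℂ G}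
    (h : ∀ g, MonoidAlgebra.single g 1 * x = x * MonoidAlgebra.single g 1)
    (y : MonoidAlgebra ℂ G) : y * x = x * y := by
  rw [eq_sum_single y, Finset.sum_mul, Finset.mul_sum]
  exact Finset.sum_congr rfl fun g _ => by rw [smul_mul_assoc, mul_smul_comm, h]

lemma trace_mulLeft (x : MonoidAlgebra ℂ G) :
    LinearMap.trace ℂ (MonoidAlgebra ℂ G) (LinearMap.mulLeft ℂ x) = Fintype.card G * tr x := by
  classical
  let b : Module.Basis G ℂ (MonoidAlgebra ℂ G) :=
    Module.Basis.ofRepr (MonoidAlgebra.coeffLinearEquiv ℂ)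
  have hb : ∀ g, b g = MonoidAlgebra.single g 1 := fun g => rfl
  rw [LinearMap.trace_eq_matrix_trace ℂ b, Matrix.trace]
  have h : ∀ g, (LinearMap.toMatrix b b (LinearMap.mulLeft ℂ x)).diag g = tr x := by
    intro g
    rw [Matrix.diag_apply, LinearMap.toMatrix_apply, hb, LinearMap.mulLeft_apply]
    change (x * MonoidAlgebra.single g 1).coeff g = _
    simp [MonoidAlgebra.coeff_mul_single_apply, tr_apply]
  rw [Finset.sum_congr rfl fun g _ => h g]
  simp

/-- An idempotent of the group algebra vanishes if its identity coefficient does: `|G|` times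
this coefficient is the trace of left multiplication, which is the rank of a projection. -/
lemma eq_zero_of_idempotent_of_tr {x : MonoidAlgebra ℂ G} (hx : x * x = x) (h : tr x = 0) :
    x = 0 := by
  have hid : IsIdempotentElem (LinearMap.mulLeft ℂ x) := by
    refine LinearMap.ext fun y => ?_
    simp [← mul_assoc, hx]
  have hp := LinearMap.IsIdempotentElem.isProj_range _ hid
  have ht := hp.trace
  rw [trace_mulLeft, h, mul_zero, eq_comm, Nat.cast_eq_zero] at ht
  have h0 := Submodule.finrank_eq_zero.1 ht
  have : LinearMap.mulLeft ℂ x = 0 := LinearMap.range_eq_bot.1 h0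
  simpa using LinearMap.congr_fun this 1

end GroupAlgebra

section Primitive

variable {G : Type*} [Group G] {X : MonoidAlgebra ℂ G} {α : ℂ}

/-- `X / α` is a primitive idempotent of the group algebra, `X` having identity coefficient `1`:
the compression `X x X` is the scalar `α · tr (X x)` times `X`. -/
structure IsPrimitive (X : MonoidAlgebra ℂ G) (α : ℂ) : Prop where
  ne_zero : α ≠ 0
  tr_eq : tr X = 1
  mul_mul : ∀ x, X * x * X = (α * tr (X * x)) • X

lemma IsPrimitive.mul_self (h : IsPrimitive X α) : X * X = α • X := by
  simpa [h.tr_eq] using h.mul_mul 1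

/-- The compression `α⁻¹ e X e` of `X` by an idempotent `e` with `tr (X e) = 1` is idempotent. -/
lemma IsPrimitive.compress_mul_self (h : IsPrimitive X α) {e : MonoidAlgebra ℂ G}
    (he : e * e = e) (ht : tr (X * e) = 1) :
    (α⁻¹ • (e * X * e)) * (α⁻¹ • (e * X * e)) = α⁻¹ • (e * X * e) := by
  have h1 : (e * X * e) * (e * X * e) = α • (e * X * e) := by
    have : (e * X * e) * (e * X * e) = e * (X * (e * e) * X) * e := by simp only [mul_assoc]
    rw [this, he, h.mul_mul, ht, mul_one, mul_smul_comm, smul_mul_assoc]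
  rw [smul_mul_smul_comm, h1, smul_smul, mul_assoc, inv_mul_cancel₀ h.ne_zero, mul_one]

lemma tr_compress {e : MonoidAlgebra ℂ G}
    (he : e * e = e) (ht : tr (X * e) = 1) : tr (α⁻¹ • (e * X * e)) = α⁻¹ := by
  rw [map_smul, mul_assoc, tr_mul_comm, mul_assoc, he, ht, smul_eq_mul, mul_one]

lemma IsPrimitive.compress_mul_mul (h : IsPrimitive X α) {e : MonoidAlgebra ℂ G}
    (ht : tr (X * e) = 1) :
    (α⁻¹ • (e * X * e)) * X * (α⁻¹ • (e * X * e)) = α • (α⁻¹ • (e * X * e)) := by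
  have h1 : (e * X * e) * X * (e * X * e) = (α * α) • (e * X * e) := by
    have : (e * X * e) * X * (e * X * e) = e * ((X * e * X) * e * X) * e := by
      simp only [mul_assoc]
    rw [this, h.mul_mul, ht, mul_one, smul_mul_assoc, smul_mul_assoc, h.mul_mul, ht, mul_one,
      mul_smul_comm, mul_smul_comm, smul_mul_assoc, smul_mul_assoc, smul_smul]
  have hα := h.ne_zero
  rw [smul_mul_assoc, smul_mul_assoc, mul_smul_comm, h1, smul_smul, smul_smul, smul_smul]
  congr 1
  field_simp

variable [Fintype G]

/-- The central idempotent of the isotypic component that contains `X`. -/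
def centralIdem (X : MonoidAlgebra ℂ G) (α : ℂ) : MonoidAlgebra ℂ G :=
  (α⁻¹ * α⁻¹) • ∑ w : G, MonoidAlgebra.single w 1 * X * MonoidAlgebra.single w⁻¹ 1

lemma centralIdem_conj (X : MonoidAlgebra ℂ G) (α : ℂ) (g : G) :
    centralIdem (MonoidAlgebra.single g 1 * X * MonoidAlgebra.single g⁻¹ 1) α =
      centralIdem X α := by
  unfold centralIdem
  congr 1
  conv_rhs => rw [← Equiv.sum_comp (Equiv.mulRight g)]
  refine Finset.sum_congr rfl fun w _ => ?_
  have h1 : (MonoidAlgebra.single (w * g) (1 : ℂ)) =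
      MonoidAlgebra.single w 1 * MonoidAlgebra.single g 1 := by
    rw [MonoidAlgebra.single_mul_single, one_mul]
  have h2 : (MonoidAlgebra.single (w * g)⁻¹ (1 : ℂ)) =
      MonoidAlgebra.single g⁻¹ 1 * MonoidAlgebra.single w⁻¹ 1 := by
    rw [MonoidAlgebra.single_mul_single, one_mul, mul_inv_rev]
  rw [Equiv.coe_mulRight, h1, h2]
  simp only [mul_assoc]

lemma centralIdem_comm (X : MonoidAlgebra ℂ G) (α : ℂ) (y : MonoidAlgebra ℂ G) :
    y * centralIdem X α = centralIdem X α * y := by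
  refine commute_of_forall_single (fun g => ?_) y
  unfold centralIdem
  rw [mul_smul_comm, smul_mul_assoc, Finset.mul_sum, Finset.sum_mul]
  congr 1
  rw [← Equiv.sum_comp (Equiv.mulLeft g)
    fun w => MonoidAlgebra.single w (1 : ℂ) * X * MonoidAlgebra.single w⁻¹ 1 *
      MonoidAlgebra.single g 1]
  refine Finset.sum_congr rfl fun w _ => ?_
  rw [Equiv.coe_mulLeft, mul_assoc _ _ (MonoidAlgebra.single g 1),
    MonoidAlgebra.single_mul_single, ← mul_assoc, ← mul_assoc, MonoidAlgebra.single_mul_single]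
  simp

lemma IsPrimitive.tr_centralIdem (h : IsPrimitive X α) :
    tr (centralIdem X α) = Fintype.card G * (α⁻¹ * α⁻¹) := by
  have : ∀ w : G, tr (MonoidAlgebra.single w 1 * X * MonoidAlgebra.single w⁻¹ 1) = 1 := by
    intro w
    rw [tr_mul_comm, ← mul_assoc, MonoidAlgebra.single_mul_single, inv_mul_cancel, one_mul,
      ← MonoidAlgebra.one_def, one_mul, h.tr_eq]
  simp [centralIdem, map_sum, this, mul_comm]

lemma IsPrimitive.centralIdem_mul (h : IsPrimitive X α) : centralIdem X α * X = X := by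
  have hα := h.ne_zero
  have key : X * centralIdem X α * X = α • X := by
    have h1 : ∀ w : G, X * (MonoidAlgebra.single w 1 * X * MonoidAlgebra.single w⁻¹ 1) * X =
        α • (X * (X.coeff w⁻¹ • MonoidAlgebra.single w⁻¹ 1) * X) := by
      intro w
      rw [← mul_assoc, ← mul_assoc, h.mul_mul, tr_mul_single, mul_one, smul_mul_assoc,
        smul_mul_assoc, mul_smul_comm, smul_mul_assoc, smul_smul]
    have h2 : ∑ w : G, X.coeff w⁻¹ • MonoidAlgebra.single w⁻¹ (1 : ℂ) = X := by
      rw [← Equiv.sum_comp (Equiv.inv G)]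
      simpa using (eq_sum_single X).symm
    unfold centralIdem
    rw [mul_smul_comm, smul_mul_assoc, Finset.mul_sum, Finset.sum_mul,
      Finset.sum_congr rfl fun w _ => h1 w, ← Finset.smul_sum, ← Finset.sum_mul,
      ← Finset.mul_sum, h2, h.mul_self, smul_mul_assoc, h.mul_self, smul_smul, smul_smul,
      smul_smul]
    congr 1
    field_simp
  rw [centralIdem_comm, mul_assoc, h.mul_self, mul_smul_comm] at key
  have := congrArg (α⁻¹ • ·) key
  simp only [smul_smul, inv_mul_cancel₀ hα, one_smul] at this
  exact this

lemma IsPrimitive.mul_centralIdem (h : IsPrimitive X α) : X * centralIdem X α = X := by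
  rw [centralIdem_comm X α X, h.centralIdem_mul]

lemma IsPrimitive.centralIdem_mul_self (h : IsPrimitive X α) :
    centralIdem X α * centralIdem X α = centralIdem X α := by
  suffices key : (α⁻¹ * α⁻¹) •
      (∑ w : G, MonoidAlgebra.single w 1 * X * MonoidAlgebra.single w⁻¹ 1) * centralIdem X α =
        centralIdem X α from key
  rw [smul_mul_assoc, Finset.sum_mul]
  refine congrArg _ ?_
  refine Finset.sum_congr rfl fun w _ => ?_
  rw [mul_assoc, centralIdem_comm, mul_assoc, ← mul_assoc X, h.mul_centralIdem, mul_assoc]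

end Primitive

/-! ### Symmetrizers of two sets that meet in one point -/

section Symmetrizer

variable {α : Type*} [Fintype α]

open Equiv

open Classical in
/-- The permutations that move only elements of `s`. -/
def young (s : Finset α) : Finset (Perm α) := {π | ∀ a, a ∉ s → π a = a}

/-- The sum of the permutations that move only elements of `s`. -/
def sym (s : Finset α) : MonoidAlgebra ℂ (Perm α) :=
  ∑ π ∈ young s, MonoidAlgebra.single π 1

/-- The signature of a permutation as a complex number. -/
def sgn (π : Perm α) : ℂ := by classical exact ((Perm.sign π : ℤ) : ℂ)

/-- The signed sum of the permutations that move only elements of `s`. -/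
def alt (s : Finset α) : MonoidAlgebra ℂ (Perm α) :=
  ∑ π ∈ young s, MonoidAlgebra.single π (sgn π)

lemma sgn_eq [DecidableEq α] (π : Perm α) : sgn π = ((Perm.sign π : ℤ) : ℂ) := by
  unfold sgn
  congr!

lemma sgn_mul (π σ : Perm α) : sgn (π * σ) = sgn π * sgn σ := by
  classical simp [sgn_eq]

@[simp] lemma sgn_one : sgn (1 : Perm α) = 1 := by
  classical simp [sgn_eq]

lemma sgn_mul_self (π : Perm α) : sgn π * sgn π = 1 := by
  classical
  rw [sgn_eq]
  rcases Int.units_eq_one_or (Perm.sign π) with h | h <;> simp [h]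

lemma sgn_inv (π : Perm α) : sgn π⁻¹ = sgn π := by
  classical simp [sgn_eq]

lemma sgn_swap [DecidableEq α] {a b : α} (h : a ≠ b) : sgn (swap a b) = -1 := by
  simp [sgn_eq, Perm.sign_swap h]

lemma mem_young {s : Finset α} {π : Perm α} : π ∈ young s ↔ ∀ a, a ∉ s → π a = a := by
  simp [young]

lemma one_mem_young (s : Finset α) : 1 ∈ young s := by simp [mem_young]

lemma mul_mem_young {s : Finset α} {π σ : Perm α} (hπ : π ∈ young s) (hσ : σ ∈ young s) :
    π * σ ∈ young s := by
  rw [mem_young] at *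
  intro a ha
  rw [Perm.mul_apply, hσ a ha, hπ a ha]

lemma inv_mem_young {s : Finset α} {π : Perm α} (hπ : π ∈ young s) : π⁻¹ ∈ young s := by
  rw [mem_young] at *
  intro a ha
  rw [Perm.inv_eq_iff_eq, hπ a ha]

lemma swap_mem_young [DecidableEq α] {s : Finset α} {a b : α} (ha : a ∈ s) (hb : b ∈ s) :
    swap a b ∈ young s := by
  rw [mem_young]
  intro c hc
  exact swap_apply_of_ne_of_ne (by rintro rfl; exact hc ha) (by rintro rfl; exact hc hb)

lemma apply_mem_of_mem_young {s : Finset α} {π : Perm α} (hπ : π ∈ young s) {a : α}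
    (ha : a ∈ s) : π a ∈ s := by
  by_contra h
  have := mem_young.1 hπ _ h
  exact h (by rwa [π.injective this])

lemma card_young (s : Finset α) : (young s).card = s.card.factorial := by
  classical
  rw [← Fintype.card_coe s, ← Fintype.card_perm, ← Fintype.card_coe]
  refine Fintype.card_congr (Equiv.trans ?_ (Perm.subtypeEquivSubtypePerm (· ∈ s)).symm)
  exact Equiv.subtypeEquivRight fun π => mem_young

lemma sum_young_mul_left {M : Type*} [AddCommMonoid M] {s : Finset α} {g : Perm α}
    (hg : g ∈ young s) (f : Perm α → M) : ∑ π ∈ young s, f (g * π) = ∑ π ∈ young s, f π := by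
  refine Finset.sum_nbij' (g * ·) (g⁻¹ * ·) (fun π h => mul_mem_young hg h)
    (fun π h => mul_mem_young (inv_mem_young hg) h) ?_ ?_ ?_ <;> simp

lemma sum_young_mul_right {M : Type*} [AddCommMonoid M] {s : Finset α} {g : Perm α}
    (hg : g ∈ young s) (f : Perm α → M) : ∑ π ∈ young s, f (π * g) = ∑ π ∈ young s, f π := by
  refine Finset.sum_nbij' (· * g) (· * g⁻¹) (fun π h => mul_mem_young h hg)
    (fun π h => mul_mem_young h (inv_mem_young hg)) ?_ ?_ ?_ <;> simp

lemma sym_mul_single {s : Finset α} {g : Perm α} (hg : g ∈ young s) :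
    sym s * MonoidAlgebra.single g 1 = sym s := by
  unfold sym
  rw [Finset.sum_mul, ← sum_young_mul_right hg fun π => MonoidAlgebra.single π (1 : ℂ)]
  simp [MonoidAlgebra.single_mul_single]

lemma single_mul_alt {s : Finset α} {g : Perm α} (hg : g ∈ young s) :
    MonoidAlgebra.single g 1 * alt s = sgn g • alt s := by
  unfold alt
  rw [Finset.mul_sum, ← sum_young_mul_left hg fun π => MonoidAlgebra.single π (sgn π),
    Finset.smul_sum]
  refine Finset.sum_congr rfl fun π _ => ?_
  rw [MonoidAlgebra.single_mul_single, one_mul, sgn_mul, MonoidAlgebra.smul_single, smul_eq_mul,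
    ← mul_assoc, sgn_mul_self, one_mul]

lemma single_mul_single_one {G : Type*} [Group G] (g h : G) :
    MonoidAlgebra.single g (1 : ℂ) * MonoidAlgebra.single h 1 = MonoidAlgebra.single (g * h) 1 := by
  rw [MonoidAlgebra.single_mul_single, one_mul]

variable {R C : Finset α}

/-- `P w N` vanishes as soon as `w` maps two elements of the column set into the row set: the
transposition of the images is absorbed by `P`, that of the elements changes the sign of `N`. -/
lemma sym_mul_mul_alt_eq_zero {w : Perm α} {x y : α} (hxy : x ≠ y) (hx : x ∈ C) (hy : y ∈ C)
    (hwx : w x ∈ R) (hwy : w y ∈ R) : sym R * MonoidAlgebra.single w 1 * alt C = 0 := by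
  classical
  have h : swap (w x) (w y) * w = w * swap x y := by
    rw [Equiv.swap_apply_apply]; group
  have h1 : sym R * MonoidAlgebra.single w 1 * alt C =
      -(sym R * MonoidAlgebra.single w 1 * alt C) := by
    conv_lhs => rw [← sym_mul_single (swap_mem_young hwx hwy), mul_assoc (sym R),
      single_mul_single_one, h, ← single_mul_single_one, ← mul_assoc, mul_assoc _ _ (alt C),
      single_mul_alt (swap_mem_young hx hy), sgn_swap hxy]
    simp
  rw [eq_neg_iff_add_eq_zero, ← two_smul ℂ] at h1
  exact (smul_eq_zero.1 h1).resolve_left two_ne_zero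

lemma sym_mul_alt_sandwich {p q : Perm α} (hp : p ∈ young R) (hq : q ∈ young C) :
    sym R * MonoidAlgebra.single (p * q) 1 * alt C = sgn q • (sym R * alt C) := by
  rw [← single_mul_single_one, ← mul_assoc, sym_mul_single hp, mul_assoc, single_mul_alt hq,
    mul_smul_comm]

/-- Two sets of labels that cover everything and have exactly the label `o` in common, like the
first row and the first column of a hook. -/
structure IsCross (R C : Finset α) (o : α) : Prop where
  mem_or : ∀ a, a ∈ R ∨ a ∈ C
  left : o ∈ R
  right : o ∈ C
  eq_of_mem : ∀ a, a ∈ R → a ∈ C → a = o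

variable {o : α}

lemma IsCross.card_add (h : IsCross R C o) : R.card + C.card = Fintype.card α + 1 := by
  classical
  have h1 : R ∪ C = Finset.univ := by
    ext a; simpa using h.mem_or a
  have h2 : R ∩ C = {o} := by
    ext a
    simp only [Finset.mem_inter, Finset.mem_singleton]
    exact ⟨fun ha => h.eq_of_mem a ha.1 ha.2, fun ha => ha ▸ ⟨h.left, h.right⟩⟩
  have := Finset.card_union_add_card_inter R C
  rw [h1, h2, Finset.card_univ, Finset.card_singleton] at this
  exact this.symm

lemma IsCross.eq_one (h : IsCross R C o) {π : Perm α} (hR : π ∈ young R) (hC : π ∈ young C) :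
    π = 1 := by
  have h1 : ∀ a, a ≠ o → π a = a := by
    intro a ha
    by_cases haR : a ∈ R
    · exact mem_young.1 hC a fun haC => ha (h.eq_of_mem a haR haC)
    · exact mem_young.1 hR a haR
  ext a
  by_cases ha : a = o
  · subst ha
    by_contra hne
    exact hne (by simpa using π.injective (h1 _ hne))
  · simp [h1 a ha]

lemma IsCross.tr_sym_mul_alt (h : IsCross R C o) : tr (sym R * alt C) = 1 := by
  classical
  unfold sym alt
  rw [Finset.sum_mul_sum, map_sum, Finset.sum_eq_single_of_mem 1 (one_mem_young R), map_sum,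
    Finset.sum_eq_single_of_mem 1 (one_mem_young C)]
  · simp [MonoidAlgebra.single_mul_single, tr_single]
  · intro q _ hq1
    simp [MonoidAlgebra.single_mul_single, tr_single, hq1]
  · intro p hp hp1
    rw [map_sum]
    refine Finset.sum_eq_zero fun q hq => ?_
    rw [MonoidAlgebra.single_mul_single, tr_single, if_neg]
    intro hpq
    rw [mul_eq_one_iff_eq_inv] at hpq
    exact hp1 (h.eq_one hp (hpq ▸ inv_mem_young hq))

/-- Every permutation that maps no two elements of `C` into `R` is a product of a permutation of
`R` and a permutation of `C`. -/
lemma IsCross.exists_factor (h : IsCross R C o) {w : Perm α}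
    (hw : ∀ x ∈ C, ∀ y ∈ C, w x ∈ R → w y ∈ R → x = y) :
    ∃ p ∈ young R, ∃ q ∈ young C, w = p * q := by
  classical
  -- Counting shows that exactly one element of `C` is mapped into `R`.
  obtain ⟨x, hxC, hxR⟩ : ∃ x ∈ C, w x ∈ R := by
    by_contra! hno
    have h1 : C.card ≤ Rᶜ.card := Finset.card_le_card_of_injOn w
      (fun x hx => by simpa using hno x hx) w.injective.injOn
    have h2 := h.card_add
    have h3 : Rᶜ.card + R.card = Fintype.card α := Finset.card_compl_add_card R
    omega
  let v := swap o (w x) * w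
  have hvx : v x = o := by simp [v]
  have hv : ∀ y ∈ C, v y ∈ C := by
    intro y hy
    by_cases hyx : y = x
    · rw [hyx, hvx]; exact h.right
    · have hyR : w y ∉ R := fun hwy => hyx (hw y hy x hxC hwy hxR)
      have : v y = w y := by
        simp only [v, Perm.mul_apply]
        exact swap_apply_of_ne_of_ne (fun e => hyR (e ▸ h.left)) (fun e => hyR (e ▸ hxR))
      rw [this]
      exact (h.mem_or _).resolve_left hyR
  have hv' : ∀ y, y ∈ C ↔ v y ∈ C := by
    have himg : C.image v = C := Finset.eq_of_subset_of_card_le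
      (Finset.image_subset_iff.2 hv) (Finset.card_image_of_injective C v.injective).ge
    intro y
    refine ⟨hv y, fun hy => ?_⟩
    rw [← himg, Finset.mem_image] at hy
    obtain ⟨z, hz, hzy⟩ := hy
    rwa [← v.injective hzy]
  let q : Perm α := Perm.ofSubtype (v.subtypePerm (p := (· ∈ C)) fun y => (hv' y).symm)
  have hq : q ∈ young C := mem_young.2 fun a ha => Perm.ofSubtype_apply_of_not_mem _ ha
  refine ⟨swap o (w x) * (v * q⁻¹), mul_mem_young (swap_mem_young h.left hxR) ?_, q, hq, ?_⟩
  · rw [mem_young]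
    intro a ha
    have haC := (h.mem_or a).resolve_left ha
    have hqa : q⁻¹ a ∈ C := apply_mem_of_mem_young (inv_mem_young hq) haC
    have : q (q⁻¹ a) = v (q⁻¹ a) := Perm.ofSubtype_apply_of_mem _ hqa
    rw [Perm.mul_apply, ← this]
    exact q.apply_symm_apply a
  · rw [mul_assoc, mul_assoc, inv_mul_cancel, mul_one, ← mul_assoc, swap_mul_self, one_mul]

lemma IsCross.sandwich (h : IsCross R C o) (x : MonoidAlgebra ℂ (Perm α)) :
    sym R * x * alt C = tr (sym R * x * alt C) • (sym R * alt C) := by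
  suffices hc : ∃ c : ℂ, sym R * x * alt C = c • (sym R * alt C) by
    obtain ⟨c, hc⟩ := hc
    rw [hc, map_smul, h.tr_sym_mul_alt, smul_eq_mul, mul_one]
  induction x using MonoidAlgebra.induction_linear with
  | zero => exact ⟨0, by simp⟩
  | add x y hx hy =>
    obtain ⟨c, hc⟩ := hx
    obtain ⟨d, hd⟩ := hy
    exact ⟨c + d, by rw [mul_add, add_mul, hc, hd, add_smul]⟩
  | single w c =>
    suffices hc : ∃ c : ℂ, sym R * MonoidAlgebra.single w 1 * alt C = c • (sym R * alt C) by
      obtain ⟨d, hd⟩ := hc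
      refine ⟨c * d, ?_⟩
      rw [mul_smul, ← hd, ← smul_mul_assoc, ← mul_smul_comm, MonoidAlgebra.smul_single,
        smul_eq_mul, mul_one]
    by_cases hw : ∀ x ∈ C, ∀ y ∈ C, w x ∈ R → w y ∈ R → x = y
    · obtain ⟨p, hp, q, hq, rfl⟩ := h.exists_factor hw
      exact ⟨sgn q, sym_mul_alt_sandwich hp hq⟩
    · push Not at hw
      obtain ⟨x, hx, y, hy, hwx, hwy, hne⟩ := hw
      exact ⟨0, by rw [sym_mul_mul_alt_eq_zero hne hx hy hwx hwy, zero_smul]⟩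

lemma IsCross.sandwich_mul (h : IsCross R C o) {p q : Perm α} (hp : p ∈ young R)
    (hq : q ∈ young C) [Decidable (p o = o ∨ q o = o)] :
    sym R * MonoidAlgebra.single (q * p) 1 * alt C =
      (if p o = o ∨ q o = o then sgn q else 0) • (sym R * alt C) := by
  have hpC : ∀ a ∈ C, a ≠ o → p a = a := fun a ha hao =>
    mem_young.1 hp a fun haR => hao (h.eq_of_mem a haR ha)
  have hqR : ∀ a ∈ R, a ≠ o → q a = a := fun a ha hao =>
    mem_young.1 hq a fun haC => hao (h.eq_of_mem a ha haC)
  split_ifs with ho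
  · have hcomm : q * p = p * q := by
      ext a
      simp only [Perm.mul_apply]
      rcases ho with ho | ho
      · have hpC' : ∀ a ∈ C, p a = a := fun a ha => by
          by_cases hao : a = o
          · rw [hao, ho]
          · exact hpC a ha hao
        by_cases ha : a ∈ C
        · rw [hpC' a ha, hpC' _ (apply_mem_of_mem_young hq ha)]
        · rw [mem_young.1 hq a ha]
          refine mem_young.1 hq _ fun hpa => ha ?_
          rwa [← p.injective (hpC' _ hpa)]
      · have hqR' : ∀ a ∈ R, q a = a := fun a ha => by
          by_cases hao : a = o
          · rw [hao, ho]
          · exact hqR a ha hao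
        by_cases ha : a ∈ R
        · rw [hqR' a ha, hqR' _ (apply_mem_of_mem_young hp ha)]
        · rw [mem_young.1 hp a ha]
          refine (mem_young.1 hp _ fun hqa => ha ?_).symm
          rwa [← q.injective (hqR' _ hqa)]
    rw [hcomm, sym_mul_alt_sandwich hp hq]
  · push Not at ho
    have hpo := apply_mem_of_mem_young hp h.left
    have hqo : q⁻¹ o ∈ C := apply_mem_of_mem_young (inv_mem_young hq) h.right
    have hqo' : q⁻¹ o ≠ o := fun e => ho.2 (Perm.inv_eq_iff_eq.1 e).symm
    rw [zero_smul]
    refine sym_mul_mul_alt_eq_zero (x := o) (y := q⁻¹ o) hqo'.symm h.right hqo ?_ ?_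
    · rw [Perm.mul_apply, hqR _ hpo ho.1]; exact hpo
    · rw [Perm.mul_apply, hpC _ hqo hqo', show q (q⁻¹ o) = o from q.apply_symm_apply o]
      exact h.left

lemma young_filter_fix [DecidableEq α] (s : Finset α) (o : α)
    [DecidablePred fun π : Perm α => π o = o] :
    {π ∈ young s | π o = o} = young (s.erase o) := by
  ext π
  simp only [Finset.mem_filter, mem_young, Finset.mem_erase, not_and_or, not_not]
  constructor
  · rintro ⟨h1, h2⟩ a (rfl | ha)
    · exact h2
    · exact h1 a ha
  · intro h
    exact ⟨fun a ha => h a (Or.inr ha), h o (Or.inl rfl)⟩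

/-- The quasi-idempotency of the Young symmetrizer of a hook. In the expansion of `P N P N` the
products `P q p N` survive only if `p` or `q` fixes the corner, which leaves
`r! (c-1)! + (r-1)! c! - (r-1)! (c-1)!` equal terms. -/
lemma IsCross.mul_self (h : IsCross R C o) :
    (sym R * alt C) * (sym R * alt C) =
      (((R.card - 1).factorial * (C.card - 1).factorial * Fintype.card α : ℕ) : ℂ) •
        (sym R * alt C) := by
  classical
  have h1 : (sym R * alt C) * (sym R * alt C) = ∑ q ∈ young C, ∑ p ∈ young R,
      sgn q • (sym R * MonoidAlgebra.single (q * p) 1 * alt C) := by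
    have : (sym R * alt C) * (sym R * alt C) = sym R * (alt C * sym R) * alt C := by
      simp only [mul_assoc]
    rw [this]
    conv_lhs => enter [1, 2]; rw [alt, sym, Finset.sum_mul_sum]
    rw [Finset.mul_sum, Finset.sum_mul]
    refine Finset.sum_congr rfl fun q _ => ?_
    rw [Finset.mul_sum, Finset.sum_mul]
    refine Finset.sum_congr rfl fun p _ => ?_
    rw [MonoidAlgebra.single_mul_single, mul_one, ← smul_mul_assoc, ← mul_smul_comm,
      MonoidAlgebra.smul_single, smul_eq_mul, mul_one]
  have h2 : ∀ q ∈ young C, ∑ p ∈ young R,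
      sgn q • (sym R * MonoidAlgebra.single (q * p) 1 * alt C) =
      ((∑ p ∈ young R, if p o = o ∨ q o = o then 1 else 0 : ℕ) : ℂ) • (sym R * alt C) := by
    intro q hq
    rw [Nat.cast_sum, Finset.sum_smul]
    refine Finset.sum_congr rfl fun p hp => ?_
    rw [h.sandwich_mul hp hq, smul_smul]
    split_ifs
    · rw [sgn_mul_self]; simp
    · simp
  rw [h1, Finset.sum_congr rfl h2, ← Finset.sum_smul, ← Nat.cast_sum]
  congr 2
  have hr := h.card_add
  have hR : 1 ≤ R.card := Finset.card_pos.2 ⟨o, h.left⟩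
  have hC : 1 ≤ C.card := Finset.card_pos.2 ⟨o, h.right⟩
  have hfix : ∀ q : Perm α, (∑ p ∈ young R, if p o = o ∨ q o = o then 1 else 0 : ℕ) =
      (R.card - 1).factorial + if q o = o then R.card.factorial - (R.card - 1).factorial
        else 0 := by
    intro q
    have hle : (R.card - 1).factorial ≤ R.card.factorial :=
      Nat.factorial_le (Nat.sub_le _ _)
    by_cases hq : q o = o
    · simp only [hq, or_true, if_true, Finset.sum_const, smul_eq_mul, mul_one, card_young]
      omega
    · simp only [hq, or_false, if_false, add_zero]
      rw [← Finset.card_filter, young_filter_fix, card_young, Finset.card_erase_of_mem h.left]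
  rw [Finset.sum_congr rfl fun q _ => hfix q, Finset.sum_add_distrib, Finset.sum_const,
    ← Finset.sum_filter, young_filter_fix, Finset.sum_const, card_young, card_young,
    Finset.card_erase_of_mem h.right, smul_eq_mul, smul_eq_mul]
  obtain ⟨r, hr'⟩ := Nat.exists_eq_add_of_le' hR
  obtain ⟨c, hc'⟩ := Nat.exists_eq_add_of_le' hC
  rw [hr', hc'] at hr ⊢
  have hn : Fintype.card α = r + c + 1 := by omega
  rw [hn, Nat.add_sub_cancel, Nat.add_sub_cancel, Nat.factorial_succ, Nat.factorial_succ]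
  have : (r + 1) * r.factorial - r.factorial = r * r.factorial := by
    rw [Nat.add_mul, one_mul, Nat.add_sub_cancel]
  rw [this]
  ring

lemma IsCross.isPrimitive (h : IsCross R C o) :
    IsPrimitive (sym R * alt C)
      (((R.card - 1).factorial * (C.card - 1).factorial * Fintype.card α : ℕ) : ℂ) where
  ne_zero := by
    have : Nonempty α := ⟨o⟩
    have := Fintype.card_pos (α := α)
    exact Nat.cast_ne_zero.2 (by positivity)
  tr_eq := h.tr_sym_mul_alt
  mul_mul x := by
    set X := sym R * alt C with hX
    have h1 : X * x * X = sym R * (alt C * x * sym R) * alt C := by simp only [hX, mul_assoc]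
    have h2 : tr (X * x * X) = tr (X * X * x) := by
      rw [tr_mul_comm, ← mul_assoc]
    rw [h1, h.sandwich, ← h1, h2, h.mul_self, smul_mul_assoc, map_smul, smul_eq_mul]

/-- The sum of the transpositions `(a b)` over all ordered pairs, where `(a a)` is the identity;
up to multiples of the identity it is twice the sum of all transpositions. -/
def transSum (α : Type*) [Fintype α] [DecidableEq α] : MonoidAlgebra ℂ (Perm α) :=
  ∑ a, ∑ b, MonoidAlgebra.single (swap a b) 1

lemma transSum_comm [DecidableEq α] (y : MonoidAlgebra ℂ (Perm α)) :
    y * transSum α = transSum α * y := by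
  refine commute_of_forall_single (fun g => ?_) y
  unfold transSum
  simp only [Finset.mul_sum, Finset.sum_mul]
  conv_rhs => rw [← Equiv.sum_comp g]
  refine Finset.sum_congr rfl fun a _ => ?_
  conv_rhs => rw [← Equiv.sum_comp g]
  refine Finset.sum_congr rfl fun b _ => ?_
  rw [single_mul_single_one, single_mul_single_one, Equiv.swap_apply_apply]
  group

lemma IsCross.sandwich_swap [DecidableEq α] (h : IsCross R C o) (a b : α) :
    sym R * MonoidAlgebra.single (swap a b) 1 * alt C =
      ((if a ∈ R then 1 else 0) * (if b ∈ R then 1 else 0) -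
        (if a ∈ C then 1 else 0) * (if b ∈ C then 1 else 0) +
        (if a = b then (1 - (if a ∈ R then 1 else 0) + (if a ∈ C then 1 else 0)) else 0) : ℂ) •
        (sym R * alt C) := by
  by_cases hab : a = b
  · subst hab
    rw [swap_self, ← Perm.one_def, ← MonoidAlgebra.one_def, mul_one]
    rw [if_pos rfl]
    split_ifs <;> simp
  · rw [if_neg hab, add_zero]
    have hRR : a ∈ R → b ∈ R → sym R * MonoidAlgebra.single (swap a b) 1 * alt C =
        sym R * alt C := fun ha hb => by rw [sym_mul_single (swap_mem_young ha hb)]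
    have hCC : a ∈ C → b ∈ C → sym R * MonoidAlgebra.single (swap a b) 1 * alt C =
        -(sym R * alt C) := fun ha hb => by
      rw [mul_assoc, single_mul_alt (swap_mem_young ha hb), sgn_swap hab, mul_smul_comm]
      simp
    have key : ∀ {a b : α}, a ∈ R → a ∉ C → b ∈ C → b ∉ R →
        sym R * MonoidAlgebra.single (swap a b) 1 * alt C = 0 := fun {a b} ha ha' hb hb' => by
      refine sym_mul_mul_alt_eq_zero (x := b) (y := o) (fun e => hb' (e ▸ h.left)) hb h.right
        (by rwa [swap_apply_right]) ?_
      rw [swap_apply_of_ne_of_ne (fun e => ha' (by rw [← e]; exact h.right))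
        (fun e => hb' (by rw [← e]; exact h.left))]
      exact h.left
    by_cases haR : a ∈ R <;> by_cases haC : a ∈ C <;> by_cases hbR : b ∈ R <;>
      by_cases hbC : b ∈ C
    · exact absurd ((h.eq_of_mem a haR haC).trans (h.eq_of_mem b hbR hbC).symm) hab
    · simp [haR, haC, hbR, hbC, hRR]
    · simp [haR, haC, hbR, hbC, hCC]
    · exact absurd (h.mem_or b) (by tauto)
    · simp [haR, haC, hbR, hbC, hRR]
    · simp [haR, haC, hbR, hbC, hRR]
    · simp [haR, haC, hbR, hbC, key]
    · exact absurd (h.mem_or b) (by tauto)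
    · simp [haR, haC, hbR, hbC, hCC]
    · rw [swap_comm, key hbR hbC haC haR]; simp [haR, haC, hbR, hbC]
    · simp [haR, haC, hbR, hbC, hCC]
    · exact absurd (h.mem_or b) (by tauto)
    all_goals exact absurd (h.mem_or a) (by tauto)

lemma IsCross.transSum_mul [DecidableEq α] (h : IsCross R C o) :
    transSum α * (sym R * alt C) =
      ((R.card : ℂ) ^ 2 - ((C.card : ℂ) - 1) ^ 2) • (sym R * alt C) := by
  rw [← mul_assoc, ← transSum_comm]
  unfold transSum
  simp only [Finset.mul_sum, Finset.sum_mul, h.sandwich_swap, ← Finset.sum_smul]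
  congr 1
  have hc : (R.card : ℂ) + C.card = Fintype.card α + 1 := by exact_mod_cast h.card_add
  simp only [Finset.sum_add_distrib, Finset.sum_sub_distrib, ← Finset.mul_sum, ← Finset.sum_mul,
    Finset.sum_ite_eq, Finset.mem_univ, if_true]
  simp only [Finset.sum_ite_mem, Finset.univ_inter, Finset.sum_const, nsmul_eq_mul, mul_one,
    Finset.card_univ]
  rw [eq_sub_of_add_eq' hc]
  ring

end Symmetrizer

/-! ### The inclusion of the smaller group algebra -/

section Inclusion

open Equiv

/-- The permutation of the first `n` labels, regarded as a permutation that fixes the last of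
`n + 1` labels. -/
def up {n : ℕ} : Perm (Fin n) →* Perm (Fin (n + 1)) :=
  Perm.viaEmbeddingHom (Fin.castSuccEmb (n := n))

variable {n : ℕ}

@[simp] lemma up_castSucc (π : Perm (Fin n)) (a : Fin n) : up π a.castSucc = (π a).castSucc :=
  Perm.viaEmbedding_apply π Fin.castSuccEmb a

@[simp] lemma up_last (π : Perm (Fin n)) : up π (Fin.last n) = Fin.last n := by
  refine Perm.viaEmbedding_apply_of_notMem π Fin.castSuccEmb _ ?_
  rintro ⟨a, ha⟩
  exact (Fin.castSucc_lt_last a).ne ha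

lemma up_injective : Function.Injective (up (n := n)) := Perm.viaEmbeddingHom_injective _

lemma perm_ext_last {π σ : Perm (Fin (n + 1))} (h : ∀ a : Fin n, π a.castSucc = σ a.castSucc)
    (hl : π (Fin.last n) = σ (Fin.last n)) : π = σ := by
  refine Equiv.ext fun a => ?_
  induction a using Fin.lastCases with
  | last => exact hl
  | cast a => exact h a

lemma exists_up_eq {w : Perm (Fin (n + 1))} (hw : w (Fin.last n) = Fin.last n) :
    ∃ π, up π = w := by
  have hne : ∀ (v : Perm (Fin (n + 1))), v (Fin.last n) = Fin.last n → ∀ a : Fin n,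
      v a.castSucc ≠ Fin.last n := fun v hv a h =>
    (Fin.castSucc_lt_last a).ne (v.injective (h.trans hv.symm))
  have hw' : w.symm (Fin.last n) = Fin.last n := by rw [Equiv.symm_apply_eq, hw]
  refine ⟨⟨fun a => (w a.castSucc).castPred (hne w hw a),
    fun a => (w.symm a.castSucc).castPred (hne w.symm hw' a), fun a => ?_, fun a => ?_⟩, ?_⟩
  · simp
  · simp
  · refine perm_ext_last (fun a => ?_) ?_
    · rw [up_castSucc]; simp
    · rw [up_last, hw]

lemma up_swap (a b : Fin n) : up (swap a b) = swap a.castSucc b.castSucc := by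
  refine perm_ext_last (fun c => ?_) ?_
  · rw [up_castSucc, ← (Fin.castSucc_injective n).swap_apply]
  · rw [up_last, swap_apply_of_ne_of_ne (Fin.castSucc_lt_last a).ne'
      (Fin.castSucc_lt_last b).ne']

lemma sgn_up (π : Perm (Fin n)) : sgn (up π) = sgn π := by
  rw [sgn_eq, sgn_eq]
  congr 2
  classical
  convert Perm.sign_extendDomain π (Equiv.ofInjective _ (Fin.castSucc_injective n))
  unfold up Perm.viaEmbeddingHom Perm.extendDomainHom
  simp only [MonoidHom.coe_mk, OneHom.coe_mk]
  congr!

@[simp] lemma inclusion_single (π : Perm (Fin n)) (c : ℂ) :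
    inclusion n (MonoidAlgebra.single π c) = MonoidAlgebra.single (up π) c := by
  simp [inclusion, up]

lemma inclusion_smul (c : ℂ) (x : GroupAlg n) : inclusion n (c • x) = c • inclusion n x := by
  induction x using MonoidAlgebra.induction_linear with
  | zero => simp
  | add x y hx hy => rw [smul_add, map_add, hx, hy, map_add, smul_add]
  | single g d => rw [MonoidAlgebra.smul_single, inclusion_single, inclusion_single,
      MonoidAlgebra.smul_single]

lemma tr_inclusion_mul_single_up (x : GroupAlg n) (π : Perm (Fin n)) (c : ℂ) :
    tr (inclusion n x * MonoidAlgebra.single (up π) c) =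
      tr (x * MonoidAlgebra.single π c) := by
  classical
  induction x using MonoidAlgebra.induction_linear with
  | zero => simp
  | add x y hx hy => simp only [map_add, add_mul, hx, hy]
  | single g d =>
    rw [inclusion_single, MonoidAlgebra.single_mul_single, MonoidAlgebra.single_mul_single,
      tr_single, tr_single, ← map_mul]
    simp only [map_eq_one_iff up up_injective]

lemma tr_inclusion_mul_single_of_ne (x : GroupAlg n) {w : Perm (Fin (n + 1))}
    (hw : w (Fin.last n) ≠ Fin.last n) (c : ℂ) :
    tr (inclusion n x * MonoidAlgebra.single w c) = 0 := by
  classical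
  induction x using MonoidAlgebra.induction_linear with
  | zero => simp
  | add x y hx hy => simp only [map_add, add_mul, hx, hy, add_zero]
  | single g d =>
    rw [inclusion_single, MonoidAlgebra.single_mul_single, tr_single, if_neg]
    intro h
    refine hw ?_
    rw [mul_eq_one_iff_eq_inv'] at h
    rw [h, Perm.inv_eq_iff_eq, up_last]

/-- The labels other than the last one in a set of labels. -/
def restrict (s : Finset (Fin (n + 1))) : Finset (Fin n) := {a | a.castSucc ∈ s}

lemma mem_restrict {s : Finset (Fin (n + 1))} {a : Fin n} :
    a ∈ restrict s ↔ a.castSucc ∈ s := by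
  simp [restrict]

lemma up_mem_young {s : Finset (Fin (n + 1))} {π : Perm (Fin n)} :
    up π ∈ young s ↔ π ∈ young (restrict s) := by
  simp only [mem_young, mem_restrict]
  constructor
  · intro h a ha
    have := h _ ha
    rw [up_castSucc] at this
    exact Fin.castSucc_injective n this
  · intro h a ha
    induction a using Fin.lastCases with
    | last => simp
    | cast a => rw [up_castSucc, h a ha]

/-- A product `p q` of a row and a column permutation fixes the last label only if both factors
do, so that pairing with the smaller group algebra sees only the smaller symmetrizers. -/
lemma IsCross.tr_inclusion_mul {R C : Finset (Fin (n + 1))} {o : Fin (n + 1)}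
    (h : IsCross R C o) (x : GroupAlg n) :
    tr (inclusion n x * (sym R * alt C)) =
      tr (x * (sym (restrict R) * alt (restrict C))) := by
  have expand : ∀ {m : ℕ} (y : GroupAlg m) (R C : Finset (Fin m)),
      tr (y * (sym R * alt C)) =
        ∑ z ∈ young R ×ˢ young C, tr (y * MonoidAlgebra.single (z.1 * z.2) (sgn z.2)) := by
    intro m y R C
    unfold sym alt
    rw [Finset.sum_mul_sum, ← Finset.sum_product', Finset.mul_sum, map_sum]
    simp only [MonoidAlgebra.single_mul_single, one_mul]
  rw [expand, expand]
  symm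
  refine Finset.sum_of_injOn (fun z => (up z.1, up z.2)) ?_ ?_ ?_ ?_
  · rintro ⟨p, q⟩ _ ⟨p', q'⟩ _ hpq
    simp only [Prod.mk.injEq] at hpq
    rw [up_injective hpq.1, up_injective hpq.2]
  · rintro ⟨p, q⟩ hpq
    simpa [up_mem_young] using hpq
  · rintro ⟨p, q⟩ hpq hno
    simp only [Finset.mem_product] at hpq
    refine tr_inclusion_mul_single_of_ne x (fun hfix => hno ?_) _
    rw [Perm.mul_apply] at hfix
    have hq : q (Fin.last n) = Fin.last n := by
      by_cases hC : Fin.last n ∈ C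
      · have hqC := apply_mem_of_mem_young hpq.2 hC
        by_cases hR : Fin.last n ∈ R
        · by_cases hqR : q (Fin.last n) ∈ R
          · rw [h.eq_of_mem _ hqR hqC, h.eq_of_mem _ hR hC]
          · rwa [mem_young.1 hpq.1 _ hqR] at hfix
        · exact p.injective (hfix.trans (mem_young.1 hpq.1 _ hR).symm)
      · exact mem_young.1 hpq.2 _ hC
    rw [hq] at hfix
    obtain ⟨p', rfl⟩ := exists_up_eq hfix
    obtain ⟨q', rfl⟩ := exists_up_eq hq
    refine ⟨(p', q'), ?_, rfl⟩
    simpa [up_mem_young] using hpq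
  · rintro ⟨p, q⟩ _
    simp only
    rw [← map_mul, tr_inclusion_mul_single_up, sgn_up]

/-- The Jucys–Murphy element of the last label: the sum of the transpositions that move it. -/
def jucysMurphy (n : ℕ) : GroupAlg (n + 1) :=
  ∑ a : Fin n, MonoidAlgebra.single (swap a.castSucc (Fin.last n)) 1

lemma transSum_succ : transSum (Fin (n + 1)) =
    inclusion n (transSum (Fin n)) + (2 : ℂ) • jucysMurphy n + 1 := by
  unfold transSum jucysMurphy
  simp only [Fin.sum_univ_castSucc, map_sum, inclusion_single, up_swap, swap_self,
    Finset.sum_add_distrib]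
  simp only [swap_comm (Fin.last n), two_smul, ← Perm.one_def, ← MonoidAlgebra.one_def]
  abel

end Inclusion

/-! ### Hook diagrams -/

section Hooks

/-- A diagram is a hook, possibly empty, if it does not contain the second diagonal box. -/
def IsHook (μ : YoungDiagram) : Prop := (1, 1) ∉ μ

lemma IsHook.or_eq_zero {μ : YoungDiagram} (h : IsHook μ) {c : ℕ × ℕ} (hc : c ∈ μ) :
    c.1 = 0 ∨ c.2 = 0 := by
  by_contra! hne
  exact h (μ.isLowerSet (Prod.le_def.2 ⟨Nat.one_le_iff_ne_zero.2 hne.1,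
    Nat.one_le_iff_ne_zero.2 hne.2⟩) hc)

/-- The hook with arm length `a` and leg length `b`, of size `a + b + 1`. -/
def hookDiagram (a b : ℕ) : YoungDiagram where
  cells := (Finset.range (a + 1)).image (fun j => (0, j)) ∪
    (Finset.range (b + 1)).image (fun i => (i, 0))
  isLowerSet := by
    intro c d hdc hc
    simp only [Finset.coe_union, Set.mem_union, Finset.mem_coe, Finset.mem_image,
      Finset.mem_range] at hc ⊢
    have hle := Prod.le_def.1 hdc
    rcases hc with ⟨j, hj, rfl⟩ | ⟨i, hi, rfl⟩
    · exact Or.inl ⟨d.2, by simp only at hle; omega, Prod.ext (by simp only at hle ⊢; omega) rfl⟩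
    · exact Or.inr ⟨d.1, by simp only at hle; omega, Prod.ext rfl (by simp only at hle ⊢; omega)⟩

lemma mem_hookDiagram {a b : ℕ} {c : ℕ × ℕ} :
    c ∈ hookDiagram a b ↔ (c.1 = 0 ∧ c.2 ≤ a) ∨ (c.2 = 0 ∧ c.1 ≤ b) := by
  rw [← YoungDiagram.mem_cells]
  obtain ⟨i, j⟩ := c
  simp only [hookDiagram, Finset.mem_union, Finset.mem_image, Finset.mem_range, Prod.mk.injEq]
  constructor
  · rintro (⟨j', h, rfl, rfl⟩ | ⟨i', h, rfl, rfl⟩)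
    · exact Or.inl ⟨rfl, by omega⟩
    · exact Or.inr ⟨rfl, by omega⟩
  · rintro (⟨rfl, h⟩ | ⟨rfl, h⟩)
    · exact Or.inl ⟨j, by omega, rfl, rfl⟩
    · exact Or.inr ⟨i, by omega, rfl, rfl⟩

lemma isHook_hookDiagram (a b : ℕ) : IsHook (hookDiagram a b) := by
  simp [IsHook, mem_hookDiagram]

lemma diagram_ext {μ ν : YoungDiagram} (h : ∀ c, c ∈ μ ↔ c ∈ ν) : μ = ν :=
  YoungDiagram.ext (Finset.ext fun c => by simpa using h c)

lemma rowLen_eq_of_forall {μ : YoungDiagram} {i m : ℕ} (h : ∀ j, (i, j) ∈ μ ↔ j < m) :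
    μ.rowLen i = m := by
  have h' : ∀ j, j < μ.rowLen i ↔ j < m := fun j => by
    rw [← h j, YoungDiagram.mem_iff_lt_rowLen]
  have h1 := h' m
  have h2 := h' (μ.rowLen i)
  omega

lemma rowLen_zero_hookDiagram (a b : ℕ) : (hookDiagram a b).rowLen 0 = a + 1 :=
  rowLen_eq_of_forall fun j => by
    simp only [mem_hookDiagram, true_and, Nat.zero_le, and_true]; omega

lemma rowLen_hookDiagram {a b i : ℕ} (hi : 0 < i) (hib : i ≤ b) :
    (hookDiagram a b).rowLen i = 1 :=
  rowLen_eq_of_forall fun j => by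
    rw [mem_hookDiagram]; simp only; omega

end Hooks

/-! ### Standard Young tableaux of hook shape -/

namespace SYT

variable {n : ℕ} {μ : YoungDiagram}

lemma box_mem (T : SYT n μ) (a : Fin n) : T.box a ∈ μ := (T.mem_iff _).2 ⟨a, rfl⟩

lemma card_eq (T : SYT n μ) : μ.card = n := by
  have : μ.cells = Finset.univ.image T.box := by
    ext c
    rw [YoungDiagram.mem_cells, T.mem_iff]
    simp
  rw [YoungDiagram.card, this, Finset.card_image_of_injective _ T.box_injective,
    Finset.card_univ, Fintype.card_fin]

lemma eq_bot (T : SYT 0 μ) : μ = ⊥ :=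
  diagram_ext fun c => by
    rw [T.mem_iff]
    simp

/-- The labels of the boxes in the first row. -/
def firstRow (T : SYT n μ) : Finset (Fin n) := {a | (T.box a).1 = 0}

/-- The labels of the boxes in the first column. -/
def firstCol (T : SYT n μ) : Finset (Fin n) := {a | (T.box a).2 = 0}

@[simp] lemma mem_firstRow {T : SYT n μ} {a : Fin n} : a ∈ T.firstRow ↔ (T.box a).1 = 0 := by
  simp [firstRow]

@[simp] lemma mem_firstCol {T : SYT n μ} {a : Fin n} : a ∈ T.firstCol ↔ (T.box a).2 = 0 := by
  simp [firstCol]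

lemma restrict_firstRow (T : SYT (n + 1) μ) : restrict T.firstRow = T.delete.firstRow := by
  ext a
  simp [mem_restrict, delete]

lemma restrict_firstCol (T : SYT (n + 1) μ) : restrict T.firstCol = T.delete.firstCol := by
  ext a
  simp [mem_restrict, delete]

lemma mem_deleteShape {T : SYT (n + 1) μ} {c : ℕ × ℕ} :
    c ∈ T.deleteShape ↔ c ∈ μ ∧ c ≠ T.box (Fin.last n) := by
  rw [T.delete.mem_iff, T.mem_iff]
  constructor
  · rintro ⟨a, rfl⟩
    exact ⟨⟨a.castSucc, rfl⟩, fun h => (Fin.castSucc_lt_last a).ne (T.box_injective h)⟩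
  · rintro ⟨⟨a, rfl⟩, hne⟩
    induction a using Fin.lastCases with
    | last => exact absurd rfl hne
    | cast a => exact ⟨a, rfl⟩

lemma isHook_deleteShape (h : IsHook μ) (T : SYT (n + 1) μ) : IsHook T.deleteShape :=
  fun hmem => h (mem_deleteShape.1 hmem).1

lemma isCross (h : IsHook μ) (T : SYT (n + 1) μ) : ∃ o, IsCross T.firstRow T.firstCol o := by
  have h0 : ((0, 0) : ℕ × ℕ) ∈ μ := μ.isLowerSet (Prod.le_def.2 ⟨Nat.zero_le _, Nat.zero_le _⟩)
    (T.box_mem 0)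
  obtain ⟨o, ho⟩ := (T.mem_iff _).1 h0
  refine ⟨o, fun a => ?_, by simp [ho], by simp [ho], fun a ha ha' => T.box_injective ?_⟩
  · simpa using h.or_eq_zero (T.box_mem a)
  · rw [ho]
    exact Prod.ext (by simpa using ha) (by simpa using ha')

lemma rowSum_eq (h : IsHook μ) (T : SYT n μ) : T.rowSum = sym T.firstRow := by
  classical
  unfold rowSum sym
  refine Finset.sum_congr (Finset.ext fun π => ?_) fun _ _ => rfl
  rw [mem_young, Finset.mem_filter]
  constructor
  · rintro ⟨-, hπ⟩ a ha
    rw [mem_firstRow] at ha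
    have h1 : (T.box a).2 = 0 := (h.or_eq_zero (T.box_mem a)).resolve_left ha
    have h2 : (T.box (π a)).2 = 0 :=
      (h.or_eq_zero (T.box_mem (π a))).resolve_left (by rwa [hπ a])
    exact T.box_injective (Prod.ext (hπ a) (h2.trans h1.symm))
  · intro hπ
    refine ⟨Finset.mem_univ _, fun a => ?_⟩
    by_cases ha : a ∈ T.firstRow
    · have := apply_mem_of_mem_young (mem_young.2 hπ) ha
      rw [mem_firstRow] at ha this
      rw [ha, this]
    · rw [hπ a ha]

lemma colSum_eq (h : IsHook μ) (T : SYT n μ) : T.colSum = alt T.firstCol := by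
  classical
  unfold colSum alt
  refine Finset.sum_congr (Finset.ext fun π => ?_) fun π _ => by rw [sgn_eq]
  rw [mem_young, Finset.mem_filter]
  constructor
  · rintro ⟨-, hπ⟩ a ha
    rw [mem_firstCol] at ha
    have h1 : (T.box a).1 = 0 := (h.or_eq_zero (T.box_mem a)).resolve_right ha
    have h2 : (T.box (π a)).1 = 0 :=
      (h.or_eq_zero (T.box_mem (π a))).resolve_right (by rwa [hπ a])
    exact T.box_injective (Prod.ext (h2.trans h1.symm) (hπ a))
  · intro hπ
    refine ⟨Finset.mem_univ _, fun a => ?_⟩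
    by_cases ha : a ∈ T.firstCol
    · have := apply_mem_of_mem_young (mem_young.2 hπ) ha
      rw [mem_firstCol] at ha this
      rw [ha, this]
    · rw [hπ a ha]

/-- The tableau `S` extended by one box that holds the largest label. -/
def extend {ν : YoungDiagram} {b : ℕ × ℕ} (hμ : ∀ c, c ∈ μ ↔ c ∈ ν ∨ c = b) (hb : b ∉ ν)
    (S : SYT n ν) : SYT (n + 1) μ where
  box := Fin.lastCases b S.box
  box_injective := by
    intro a a'
    induction a using Fin.lastCases with
    | last =>
      induction a' using Fin.lastCases with
      | last => simp
      | cast a' =>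
        simp only [Fin.lastCases_last, Fin.lastCases_castSucc]
        intro h
        exact absurd (S.box_mem a') (by rwa [← h])
    | cast a =>
      induction a' using Fin.lastCases with
      | last =>
        simp only [Fin.lastCases_last, Fin.lastCases_castSucc]
        intro h
        exact absurd (S.box_mem a) (by rwa [h])
      | cast a' =>
        simp only [Fin.lastCases_castSucc]
        exact fun h => congrArg _ (S.box_injective h)
  mem_iff c := by
    rw [hμ, S.mem_iff]
    constructor
    · rintro (⟨a, rfl⟩ | rfl)
      · exact ⟨a.castSucc, by simp⟩
      · exact ⟨Fin.last n, by simp⟩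
    · rintro ⟨a, rfl⟩
      induction a using Fin.lastCases with
      | last => simp
      | cast a => exact Or.inl ⟨a, by simp⟩
  row_lt a a' := by
    induction a using Fin.lastCases with
    | last =>
      induction a' using Fin.lastCases with
      | last => simp
      | cast a' =>
        simp only [Fin.lastCases_last, Fin.lastCases_castSucc]
        intro h h'
        exact absurd (ν.isLowerSet (Prod.le_def.2 ⟨h.le, h'.le⟩) (S.box_mem a')) hb
    | cast a =>
      induction a' using Fin.lastCases with
      | last => exact fun _ _ => Fin.castSucc_lt_last a
      | cast a' =>
        simp only [Fin.lastCases_castSucc]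
        exact fun h h' => S.row_lt a a' h h'
  col_lt a a' := by
    induction a using Fin.lastCases with
    | last =>
      induction a' using Fin.lastCases with
      | last => simp
      | cast a' =>
        simp only [Fin.lastCases_last, Fin.lastCases_castSucc]
        intro h h'
        exact absurd (ν.isLowerSet (Prod.le_def.2 ⟨h'.le, h.le⟩) (S.box_mem a')) hb
    | cast a =>
      induction a' using Fin.lastCases with
      | last => exact fun _ _ => Fin.castSucc_lt_last a
      | cast a' =>
        simp only [Fin.lastCases_castSucc]
        exact fun h h' => S.col_lt a a' h h'

/-- Deleting the largest label is a bijection from the tableaux with this label in the box `b`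
to the tableaux of the shape without `b`. -/
lemma card_last_eq {ν : YoungDiagram} {b : ℕ × ℕ} (hμ : ∀ c, c ∈ μ ↔ c ∈ ν ∨ c = b)
    (hb : b ∉ ν) :
    Nat.card {T : SYT (n + 1) μ // T.box (Fin.last n) = b} = Nat.card (SYT n ν) := by
  symm
  refine Nat.card_congr (Equiv.ofBijective
    (fun S => ⟨extend hμ hb S, by simp [extend]⟩) ⟨?_, ?_⟩)
  · intro S S' h
    have h' := congrArg (fun T => T.1.box) h
    refine SYT.ext (funext fun a => ?_)
    simpa [extend] using congrFun h' a.castSucc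
  · rintro ⟨T, hT⟩
    have hν : T.deleteShape = ν := diagram_ext fun c => by
      rw [mem_deleteShape, hμ, hT]
      constructor
      · rintro ⟨h | h, hne⟩
        · exact h
        · exact absurd h hne
      · exact fun h => ⟨Or.inl h, fun e => hb (e ▸ h)⟩
    subst hν
    refine ⟨T.delete, Subtype.ext (SYT.ext (funext fun a => ?_))⟩
    induction a using Fin.lastCases with
    | last => simp [extend, hT]
    | cast a => simp [extend, delete]

/-- The largest label stands at the end of its row and of its column. -/
lemma last_corner (T : SYT (n + 1) μ) {c : ℕ × ℕ} (hc : c ∈ μ) (h : T.box (Fin.last n) ≤ c) :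
    c = T.box (Fin.last n) := by
  have hle := Prod.le_def.1 h
  have hmid : ((T.box (Fin.last n)).1, c.2) ∈ μ :=
    μ.isLowerSet (Prod.le_def.2 ⟨hle.1, le_rfl⟩) hc
  obtain ⟨a, ha⟩ := (T.mem_iff _).1 hmid
  obtain ⟨b, rfl⟩ := (T.mem_iff _).1 hc
  have h2 : (T.box (Fin.last n)).2 = (T.box b).2 := by
    refine hle.2.antisymm (not_lt.1 fun hlt => ?_)
    exact absurd (T.row_lt (Fin.last n) a (by rw [ha]) (by rw [ha]; exact hlt))
      (Fin.le_last a).not_gt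
  have h1 : (T.box (Fin.last n)).1 = (T.box b).1 := by
    refine hle.1.antisymm (not_lt.1 fun hlt => ?_)
    exact absurd (T.col_lt (Fin.last n) b h2 hlt) (Fin.le_last b).not_gt
  exact Prod.ext h1.symm h2.symm

lemma last_hookDiagram {a b : ℕ} (T : SYT (n + 1) (hookDiagram a b)) :
    T.box (Fin.last n) = (0, a) ∨ T.box (Fin.last n) = (b, 0) := by
  have hmem := T.box_mem (Fin.last n)
  rw [mem_hookDiagram] at hmem
  rcases hmem with ⟨h1, h2⟩ | ⟨h1, h2⟩
  · exact Or.inl (T.last_corner (mem_hookDiagram.2 (Or.inl ⟨rfl, le_rfl⟩))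
      (Prod.le_def.2 ⟨h1.le, h2⟩)).symm
  · exact Or.inr (T.last_corner (mem_hookDiagram.2 (Or.inr ⟨rfl, le_rfl⟩))
      (Prod.le_def.2 ⟨h2, h1.le⟩)).symm

lemma card_last_arm (n a b : ℕ) :
    Nat.card {T : SYT (n + 1) (hookDiagram (a + 1) b) // T.box (Fin.last n) = (0, a + 1)} =
      Nat.card (SYT n (hookDiagram a b)) := by
  refine card_last_eq (fun c => ?_) (by simp [mem_hookDiagram])
  obtain ⟨i, j⟩ := c
  rw [mem_hookDiagram, mem_hookDiagram, Prod.mk.injEq]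
  simp only
  omega

lemma card_last_leg (n a b : ℕ) :
    Nat.card {T : SYT (n + 1) (hookDiagram a (b + 1)) // T.box (Fin.last n) = (b + 1, 0)} =
      Nat.card (SYT n (hookDiagram a b)) := by
  refine card_last_eq (fun c => ?_) (by simp [mem_hookDiagram])
  obtain ⟨i, j⟩ := c
  rw [mem_hookDiagram, mem_hookDiagram, Prod.mk.injEq]
  simp only
  omega

lemma card_zero_bot : Nat.card (SYT 0 ⊥) = 1 := by
  rw [Nat.card_eq_one_iff_unique]
  refine ⟨⟨fun S T => SYT.ext (Subsingleton.elim _ _)⟩,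
    ⟨⟨fun a => a.elim0, fun a => a.elim0, fun c => by simp, fun a => a.elim0,
      fun a => a.elim0⟩⟩⟩

lemma card_last_single :
    Nat.card {T : SYT 1 (hookDiagram 0 0) // T.box (Fin.last 0) = (0, 0)} =
      Nat.card (SYT 0 ⊥) := by
  refine card_last_eq (fun c => ?_) (by simp)
  obtain ⟨i, j⟩ := c
  simp [mem_hookDiagram, and_comm]

lemma card_hookDiagram (n a b : ℕ) (hn : a + b = n) :
    Nat.card (SYT (n + 1) (hookDiagram a b)) = n.choose a := by
  have all : ∀ {n a b : ℕ} {c : ℕ × ℕ},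
      (∀ T : SYT (n + 1) (hookDiagram a b), T.box (Fin.last n) = c) →
      Nat.card (SYT (n + 1) (hookDiagram a b)) =
        Nat.card {T : SYT (n + 1) (hookDiagram a b) // T.box (Fin.last n) = c} := fun h =>
    (Nat.card_congr (Equiv.subtypeUnivEquiv h)).symm
  induction n generalizing a b with
  | zero =>
    obtain ⟨rfl, rfl⟩ : a = 0 ∧ b = 0 := by omega
    rw [all fun T => (last_hookDiagram T).elim id id, card_last_single, card_zero_bot]
    rfl
  | succ n ih =>
    match a, b, hn with
    | 0, b + 1, hn =>
      have hT : ∀ T : SYT (n + 1 + 1) (hookDiagram 0 (b + 1)),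
          T.box (Fin.last (n + 1)) = (b + 1, 0) := by
        intro T
        refine (last_hookDiagram T).resolve_left fun h => ?_
        have := T.last_corner (c := (b + 1, 0)) (mem_hookDiagram.2 (Or.inr ⟨rfl, le_rfl⟩))
          (by rw [h]; exact Prod.le_def.2 ⟨Nat.zero_le _, le_rfl⟩)
        rw [h] at this
        simp at this
      rw [all hT, card_last_leg, ih 0 b (by omega)]
      simp
    | a + 1, 0, hn =>
      have hT : ∀ T : SYT (n + 1 + 1) (hookDiagram (a + 1) 0),
          T.box (Fin.last (n + 1)) = (0, a + 1) := by
        intro T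
        refine (last_hookDiagram T).resolve_right fun h => ?_
        have := T.last_corner (c := (0, a + 1)) (mem_hookDiagram.2 (Or.inl ⟨rfl, le_rfl⟩))
          (by rw [h]; exact Prod.le_def.2 ⟨le_rfl, Nat.zero_le _⟩)
        rw [h] at this
        simp at this
      rw [all hT, card_last_arm, ih a 0 (by omega)]
      obtain rfl : a = n := by omega
      simp
    | a + 1, b + 1, hn =>
      classical
      have hnot : ∀ T : SYT (n + 1 + 1) (hookDiagram (a + 1) (b + 1)),
          ¬ T.box (Fin.last (n + 1)) = (0, a + 1) ↔ T.box (Fin.last (n + 1)) = (b + 1, 0) := by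
        intro T
        refine ⟨(last_hookDiagram T).resolve_left, fun h => ?_⟩
        rw [h]; simp
      rw [← Nat.card_congr (Equiv.sumCompl fun T : SYT (n + 1 + 1)
          (hookDiagram (a + 1) (b + 1)) => T.box (Fin.last (n + 1)) = (0, a + 1)),
        Nat.card_sum, Nat.card_congr (Equiv.subtypeEquivRight hnot), card_last_arm,
        card_last_leg, ih a (b + 1) (by omega), ih (a + 1) b (by omega), Nat.choose_succ_succ]

lemma card_eq_numSYT (h : μ.card = n) : Nat.card (SYT n μ) = numSYT μ := by
  subst h
  rfl

lemma eq_hookDiagram (h : IsHook μ) (T : SYT (n + 1) μ) :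
    μ = hookDiagram (T.firstRow.card - 1) (T.firstCol.card - 1) := by
  have hrow : T.firstRow.card = μ.rowLen 0 := by
    rw [YoungDiagram.rowLen_eq_card, ← Finset.card_image_of_injective _ T.box_injective]
    congr 1
    ext c
    rw [Finset.mem_image, YoungDiagram.mem_row_iff, T.mem_iff]
    constructor
    · rintro ⟨a, ha, rfl⟩; exact ⟨⟨a, rfl⟩, by simpa using ha⟩
    · rintro ⟨⟨a, rfl⟩, ha⟩; exact ⟨a, by simpa using ha, rfl⟩
  have hcol : T.firstCol.card = μ.colLen 0 := by
    rw [YoungDiagram.colLen_eq_card, ← Finset.card_image_of_injective _ T.box_injective]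
    congr 1
    ext c
    rw [Finset.mem_image, YoungDiagram.mem_col_iff, T.mem_iff]
    constructor
    · rintro ⟨a, ha, rfl⟩; exact ⟨⟨a, rfl⟩, by simpa using ha⟩
    · rintro ⟨⟨a, rfl⟩, ha⟩; exact ⟨a, by simpa using ha, rfl⟩
  obtain ⟨o, ho⟩ := T.isCross h
  have h1 : 0 < T.firstRow.card := Finset.card_pos.2 ⟨o, ho.left⟩
  have h2 : 0 < T.firstCol.card := Finset.card_pos.2 ⟨o, ho.right⟩
  refine diagram_ext fun c => ?_
  obtain ⟨i, j⟩ := c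
  rw [mem_hookDiagram]
  have key1 : (0, j) ∈ μ ↔ j ≤ T.firstRow.card - 1 := by
    rw [YoungDiagram.mem_iff_lt_rowLen, ← hrow]; omega
  have key2 : (i, 0) ∈ μ ↔ i ≤ T.firstCol.card - 1 := by
    rw [YoungDiagram.mem_iff_lt_colLen, ← hcol]; omega
  simp only
  constructor
  · intro hc
    rcases h.or_eq_zero hc with h0 | h0 <;> simp only at h0 <;> subst h0
    · exact Or.inl ⟨rfl, key1.1 hc⟩
    · exact Or.inr ⟨rfl, key2.1 hc⟩
  · rintro (⟨rfl, hj⟩ | ⟨rfl, hi⟩)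
    · exact key1.2 hj
    · exact key2.2 hi

lemma card_firstRow_add (h : IsHook μ) (T : SYT (n + 1) μ) :
    (T.firstRow.card - 1) + (T.firstCol.card - 1) = n := by
  obtain ⟨o, ho⟩ := T.isCross h
  have h1 : 0 < T.firstRow.card := Finset.card_pos.2 ⟨o, ho.left⟩
  have h2 : 0 < T.firstCol.card := Finset.card_pos.2 ⟨o, ho.right⟩
  have := ho.card_add
  rw [Fintype.card_fin] at this
  omega

/-- The hook length formula for hooks, in the form needed for the scalar in `(P N)² = α P N`. -/
lemma factorial_mul_numSYT (h : IsHook μ) (T : SYT (n + 1) μ) :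
    (T.firstRow.card - 1).factorial * (T.firstCol.card - 1).factorial * (n + 1) * numSYT μ =
      (n + 1).factorial := by
  have hsum := T.card_firstRow_add h
  have hcard : Nat.card (SYT (n + 1) μ) = n.choose (T.firstRow.card - 1) := by
    conv_lhs => rw [T.eq_hookDiagram h]
    exact card_hookDiagram n _ _ hsum
  rw [← card_eq_numSYT T.card_eq, hcard, Nat.factorial_succ,
    ← Nat.choose_mul_factorial_mul_factorial (show T.firstRow.card - 1 ≤ n by omega),
    show n - (T.firstRow.card - 1) = T.firstCol.card - 1 by omega]
  ring

lemma lastInRow_iff {i : ℕ} (T : SYT (n + 1) μ) : T.LastInRow i ↔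
    μ.rowLen (T.box (Fin.last n)).1 = i ∧ (T.box (Fin.last n)).2 + 1 = i := by
  constructor
  · rintro ⟨a, ha, h⟩
    obtain rfl : a = Fin.last n := Fin.ext (by simpa using ha)
    exact h
  · exact fun h => ⟨Fin.last n, rfl, h⟩

/-- Among the corners of a diagram the length of the row determines the corner. -/
lemma last_eq_of_lastInRow {i : ℕ} {T S : SYT (n + 1) μ} (hT : T.LastInRow i)
    (hS : S.LastInRow i) : T.box (Fin.last n) = S.box (Fin.last n) := by
  rw [lastInRow_iff] at hT hS
  rcases le_total (T.box (Fin.last n)).1 (S.box (Fin.last n)).1 with h | h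
  · exact (T.last_corner (S.box_mem _) (Prod.le_def.2 ⟨h, by omega⟩)).symm
  · exact S.last_corner (T.box_mem _) (Prod.le_def.2 ⟨h, by omega⟩)

end SYT

/-! ### Semi-normal units of hook tableaux -/

section Conj

open Equiv

variable {α : Type*} [Fintype α] [DecidableEq α]

lemma conj_mem_young {s : Finset α} {g π : Perm α} :
    g * π * g⁻¹ ∈ young (s.image g) ↔ π ∈ young s := by
  simp only [mem_young]
  constructor
  · intro h a ha
    have := h (g a) (by simpa using ha)
    simpa using this
  · intro h a ha
    have : g⁻¹ a ∉ s := fun h' => ha (Finset.mem_image.2 ⟨_, h', g.apply_symm_apply a⟩)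
    rw [Perm.mul_apply, Perm.mul_apply, h _ this]
    exact g.apply_symm_apply a

lemma sum_young_conj {M : Type*} [AddCommMonoid M] (s : Finset α) (g : Perm α)
    (f : Perm α → M) : ∑ π ∈ young (s.image g), f π = ∑ π ∈ young s, f (g * π * g⁻¹) := by
  symm
  refine Finset.sum_nbij' (fun π => g * π * g⁻¹) (fun π => g⁻¹ * π * g)
    (fun π h => conj_mem_young.2 h) (fun π h => ?_) ?_ ?_ fun _ _ => rfl
  · rw [← conj_mem_young (g := g)]
    convert h using 1
    group
  · intro π _; group
  · intro π _; group

lemma conj_sym (s : Finset α) (g : Perm α) :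
    MonoidAlgebra.single g 1 * sym s * MonoidAlgebra.single g⁻¹ 1 = sym (s.image g) := by
  unfold sym
  rw [sum_young_conj, Finset.mul_sum, Finset.sum_mul]
  simp only [single_mul_single_one]

lemma conj_alt (s : Finset α) (g : Perm α) :
    MonoidAlgebra.single g 1 * alt s * MonoidAlgebra.single g⁻¹ 1 = alt (s.image g) := by
  unfold alt
  rw [sum_young_conj, Finset.mul_sum, Finset.sum_mul]
  refine Finset.sum_congr rfl fun π _ => ?_
  rw [MonoidAlgebra.single_mul_single, MonoidAlgebra.single_mul_single, one_mul, mul_one,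
    sgn_mul, sgn_mul, sgn_inv, mul_right_comm, sgn_mul_self, one_mul]

lemma conj_sym_mul_alt (s u : Finset α) (g : Perm α) :
    MonoidAlgebra.single g 1 * (sym s * alt u) * MonoidAlgebra.single g⁻¹ 1 =
      sym (s.image g) * alt (u.image g) := by
  have h : MonoidAlgebra.single g⁻¹ (1 : ℂ) * MonoidAlgebra.single g 1 = 1 := by
    rw [single_mul_single_one, inv_mul_cancel, MonoidAlgebra.one_def]
  rw [← conj_sym, ← conj_alt]
  calc _ = MonoidAlgebra.single g 1 * sym s * 1 * alt u * MonoidAlgebra.single g⁻¹ 1 := by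
        simp only [mul_assoc, mul_one]
    _ = _ := by rw [← h]; simp only [mul_assoc]

end Conj

namespace SYT

variable {n : ℕ} {μ ν : YoungDiagram}

/-- The Young symmetrizer `P_T N_T`. -/
def symmetrizer (T : SYT n μ) : GroupAlg n := T.rowSum * T.colSum

lemma symmetrizer_eq (h : IsHook μ) (T : SYT n μ) :
    T.symmetrizer = sym T.firstRow * alt T.firstCol := by
  rw [symmetrizer, T.rowSum_eq h, T.colSum_eq h]

lemma numSYT_ne_zero (T : SYT n μ) : numSYT μ ≠ 0 := by
  rw [← card_eq_numSYT T.card_eq]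
  have : Nonempty (SYT n μ) := ⟨T⟩
  exact Nat.card_pos.ne'

lemma symmetrizer_zero (T : SYT 0 μ) : T.symmetrizer = 1 := by
  classical
  simp [symmetrizer, rowSum, colSum, Finset.univ_unique, MonoidAlgebra.one_def,
    MonoidAlgebra.single_mul_single]

lemma isPrimitive_symmetrizer (h : IsHook μ) (T : SYT n μ) :
    IsPrimitive T.symmetrizer ((n.factorial : ℂ) / numSYT μ) := by
  match n, T with
  | 0, T =>
    have hd : numSYT μ = 1 := by
      rw [← card_eq_numSYT T.card_eq, T.eq_bot, card_zero_bot]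
    rw [hd, T.symmetrizer_zero]
    refine ⟨by simp, MonoidAlgebra.coeff_one_one, fun x => ?_⟩
    rw [one_mul, mul_one]
    refine MonoidAlgebra.coeff_injective (Finsupp.ext fun g => ?_)
    rw [Subsingleton.elim g 1]
    simp [tr_apply]
  | n + 1, T =>
    obtain ⟨o, ho⟩ := T.isCross h
    have hp := ho.isPrimitive
    rw [← T.symmetrizer_eq h, Fintype.card_fin] at hp
    convert hp using 1
    rw [div_eq_iff (Nat.cast_ne_zero.2 T.numSYT_ne_zero)]
    exact_mod_cast (T.factorial_mul_numSYT h).symm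

lemma unit_succ (T : SYT (n + 1) μ) : T.unit = (((n + 1).factorial : ℂ) / numSYT μ)⁻¹ •
    (inclusion n T.delete.unit * T.symmetrizer * inclusion n T.delete.unit) := by
  rw [SYT.unit, inv_div, symmetrizer]
  simp only [mul_assoc]

/-- The compression of the Young symmetrizer by the unit of the smaller tableau is normalised
to have identity coefficient `1`, provided this unit has the properties asserted below. -/
lemma tr_symmetrizer_mul (h : IsHook μ) (T : SYT (n + 1) μ) {α : ℂ} (hα : α ≠ 0)
    (h1 : T.delete.unit * T.delete.unit = T.delete.unit) (h2 : tr T.delete.unit = α⁻¹)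
    (h3 : T.delete.unit * T.delete.symmetrizer * T.delete.unit = α • T.delete.unit) :
    tr (T.symmetrizer * inclusion n T.delete.unit) = 1 := by
  obtain ⟨o, ho⟩ := T.isCross h
  rw [tr_mul_comm, T.symmetrizer_eq h, ho.tr_inclusion_mul, T.restrict_firstRow,
    T.restrict_firstCol, ← T.delete.symmetrizer_eq (T.isHook_deleteShape h), ← h1, mul_assoc,
    tr_mul_comm, h3, map_smul, h2, smul_eq_mul, mul_inv_cancel₀ hα]

lemma unit_spec (h : IsHook μ) (T : SYT n μ) : T.unit * T.unit = T.unit ∧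
    tr T.unit = ((n.factorial : ℂ) / numSYT μ)⁻¹ ∧
    T.unit * T.symmetrizer * T.unit = ((n.factorial : ℂ) / numSYT μ) • T.unit := by
  induction n generalizing μ with
  | zero =>
    have hd : numSYT μ = 1 := by
      rw [← card_eq_numSYT T.card_eq, T.eq_bot, card_zero_bot]
    rw [SYT.unit, T.symmetrizer_zero, hd]
    simp [tr_apply]
  | succ n ih =>
    obtain ⟨h1, h2, h3⟩ := ih (T.isHook_deleteShape h) T.delete
    have hp := T.isPrimitive_symmetrizer h
    have ht := T.tr_symmetrizer_mul h
      (T.delete.isPrimitive_symmetrizer (T.isHook_deleteShape h)).ne_zero h1 h2 h3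
    have he : inclusion n T.delete.unit * inclusion n T.delete.unit =
        inclusion n T.delete.unit := by rw [← map_mul, h1]
    rw [T.unit_succ]
    exact ⟨hp.compress_mul_self he ht, tr_compress he ht, hp.compress_mul_mul ht⟩

lemma unit_mul_self (h : IsHook μ) (T : SYT n μ) : T.unit * T.unit = T.unit :=
  (T.unit_spec h).1

lemma tr_unit (h : IsHook μ) (T : SYT n μ) :
    tr T.unit = ((n.factorial : ℂ) / numSYT μ)⁻¹ := (T.unit_spec h).2.1

lemma unit_mul_inclusion (h : IsHook μ) (T : SYT (n + 1) μ) :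
    T.unit * inclusion n T.delete.unit = T.unit := by
  rw [T.unit_succ, smul_mul_assoc, mul_assoc, ← map_mul,
    T.delete.unit_mul_self (T.isHook_deleteShape h)]

lemma inclusion_mul_unit (h : IsHook μ) (T : SYT (n + 1) μ) :
    inclusion n T.delete.unit * T.unit = T.unit := by
  rw [T.unit_succ, mul_smul_comm, ← mul_assoc, ← mul_assoc, ← map_mul,
    T.delete.unit_mul_self (T.isHook_deleteShape h)]

lemma card_firstRow_succ (T : SYT (n + 1) μ) : T.firstRow.card =
    T.delete.firstRow.card + if (T.box (Fin.last n)).1 = 0 then 1 else 0 := by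
  simp only [firstRow, Finset.card_filter, Fin.sum_univ_castSucc]
  rfl

lemma card_firstCol_succ (T : SYT (n + 1) μ) : T.firstCol.card =
    T.delete.firstCol.card + if (T.box (Fin.last n)).2 = 0 then 1 else 0 := by
  simp only [firstCol, Finset.card_filter, Fin.sum_univ_castSucc]
  rfl

lemma one_le_card_firstRow (h : IsHook μ) (T : SYT (n + 1) μ) : 1 ≤ T.firstRow.card := by
  obtain ⟨o, ho⟩ := T.isCross h
  exact Finset.card_pos.2 ⟨o, ho.left⟩

lemma one_le_card_firstCol (h : IsHook μ) (T : SYT (n + 1) μ) : 1 ≤ T.firstCol.card := by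
  obtain ⟨o, ho⟩ := T.isCross h
  exact Finset.card_pos.2 ⟨o, ho.right⟩

lemma transSum_mul_symmetrizer (h : IsHook μ) (T : SYT (n + 1) μ) :
    transSum (Fin (n + 1)) * T.symmetrizer =
      (((n : ℂ) + 1) * (2 * T.firstRow.card - (n + 1))) • T.symmetrizer := by
  obtain ⟨o, ho⟩ := T.isCross h
  have hc : (T.firstRow.card : ℂ) + T.firstCol.card = n + 1 + 1 := by
    have := ho.card_add
    rw [Fintype.card_fin] at this
    exact_mod_cast this
  rw [T.symmetrizer_eq h, ho.transSum_mul]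
  congr 1
  rw [eq_sub_of_add_eq' hc]
  ring

lemma transSum_mul_unit (h : IsHook μ) (T : SYT (n + 1) μ) :
    transSum (Fin (n + 1)) * T.unit =
      (((n : ℂ) + 1) * (2 * T.firstRow.card - (n + 1))) • T.unit := by
  rw [T.unit_succ, mul_smul_comm, ← mul_assoc, ← mul_assoc, ← transSum_comm, mul_assoc _ _
    T.symmetrizer, T.transSum_mul_symmetrizer h, mul_smul_comm, smul_mul_assoc, smul_comm]

/-- Symmetrizers of hooks with different arm lengths are separated by the central element
`transSum`. -/
lemma symmetrizer_mul_mul_eq_zero (hμ : IsHook μ) (hν : IsHook ν) (T : SYT (n + 1) μ)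
    (S : SYT (n + 1) ν) (hne : T.firstRow.card ≠ S.firstRow.card) (x : GroupAlg (n + 1)) :
    T.symmetrizer * x * S.symmetrizer = 0 := by
  have h1 : transSum (Fin (n + 1)) * (T.symmetrizer * x * S.symmetrizer) =
      (((n : ℂ) + 1) * (2 * T.firstRow.card - (n + 1))) •
        (T.symmetrizer * x * S.symmetrizer) := by
    rw [← mul_assoc, ← mul_assoc, T.transSum_mul_symmetrizer hμ, smul_mul_assoc, smul_mul_assoc]
  have h2 : transSum (Fin (n + 1)) * (T.symmetrizer * x * S.symmetrizer) =
      (((n : ℂ) + 1) * (2 * S.firstRow.card - (n + 1))) •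
        (T.symmetrizer * x * S.symmetrizer) := by
    rw [← mul_assoc, ← transSum_comm, mul_assoc, S.transSum_mul_symmetrizer hν, mul_smul_comm]
  have h3 := h1.symm.trans h2
  rw [← sub_eq_zero, ← sub_smul] at h3
  refine (smul_eq_zero.1 h3).resolve_left fun h4 => hne ?_
  have h5 : ((n : ℂ) + 1) * (2 * ((T.firstRow.card : ℂ) - S.firstRow.card)) = 0 := by
    rw [← h4]; ring
  have h6 : (n : ℂ) + 1 ≠ 0 := by exact_mod_cast n.succ_ne_zero
  have h7 := (mul_eq_zero.1 ((mul_eq_zero.1 h5).resolve_left h6)).resolve_left two_ne_zero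
  exact_mod_cast sub_eq_zero.1 h7

lemma last_eq_of_le {T : SYT (n + 1) μ} {S : SYT (n + 1) ν} (hd : T.delete.box = S.delete.box)
    (hle : T.box (Fin.last n) ≤ S.box (Fin.last n)) :
    T.box (Fin.last n) = S.box (Fin.last n) := by
  obtain ⟨a, ha⟩ := (S.mem_iff _).1 (ν.isLowerSet hle (S.box_mem _))
  induction a using Fin.lastCases with
  | last => exact ha.symm
  | cast a =>
    have h1 : T.box a.castSucc = S.box a.castSucc := congrFun hd a
    exact absurd (T.box_injective (h1.trans ha)) (Fin.castSucc_lt_last a).ne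

/-- Two hook tableaux that differ only in the box of the last label have different arms. -/
lemma card_firstRow_ne (hμ : IsHook μ) (hν : IsHook ν) {T : SYT (n + 1) μ} {S : SYT (n + 1) ν}
    (hd : T.delete.box = S.delete.box) (hl : T.box (Fin.last n) ≠ S.box (Fin.last n)) :
    T.firstRow.card ≠ S.firstRow.card := by
  have hrow : T.delete.firstRow = S.delete.firstRow := by
    ext a; rw [mem_firstRow, mem_firstRow, hd]
  rw [card_firstRow_succ, card_firstRow_succ, hrow]
  have hcomp : ¬ (T.box (Fin.last n) ≤ S.box (Fin.last n) ∨
      S.box (Fin.last n) ≤ T.box (Fin.last n)) := by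
    rintro (h | h)
    · exact hl (last_eq_of_le hd h)
    · exact hl (last_eq_of_le hd.symm h).symm
  have hT := hμ.or_eq_zero (T.box_mem (Fin.last n))
  have hS := hν.or_eq_zero (S.box_mem (Fin.last n))
  rw [Prod.le_def, Prod.le_def] at hcomp
  split_ifs <;> omega

/-- The units of different hook tableaux, possibly of different shapes, are orthogonal. -/
lemma unit_mul_unit_of_ne (hμ : IsHook μ) (hν : IsHook ν) (T : SYT n μ) (S : SYT n ν)
    (hne : T.box ≠ S.box) : T.unit * S.unit = 0 := by
  induction n generalizing μ ν with
  | zero => exact absurd (Subsingleton.elim _ _) hne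
  | succ n ih =>
    rw [T.unit_succ, S.unit_succ, smul_mul_smul_comm]
    have key : inclusion n T.delete.unit * T.symmetrizer * inclusion n T.delete.unit *
        (inclusion n S.delete.unit * S.symmetrizer * inclusion n S.delete.unit) =
        inclusion n T.delete.unit *
          (T.symmetrizer * inclusion n (T.delete.unit * S.delete.unit) * S.symmetrizer) *
          inclusion n S.delete.unit := by
      rw [map_mul]; simp only [mul_assoc]
    rw [key]
    by_cases hd : T.delete.box = S.delete.box
    · have hl : T.box (Fin.last n) ≠ S.box (Fin.last n) := fun hl => hne <| funext fun a => by
        induction a using Fin.lastCases with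
        | last => exact hl
        | cast a => exact congrFun hd a
      rw [symmetrizer_mul_mul_eq_zero hμ hν T S (card_firstRow_ne hμ hν hd hl)]
      simp
    · rw [ih (T.isHook_deleteShape hμ) (S.isHook_deleteShape hν) _ _ hd]
      simp

/-- The central idempotent that belongs to the shape of `T`. -/
def central (T : SYT n μ) : GroupAlg n :=
  centralIdem T.symmetrizer ((n.factorial : ℂ) / numSYT μ)

lemma central_eq (h : IsHook μ) (T S : SYT n μ) : T.central = S.central := by
  classical
  have hex : ∀ a, ∃ b, T.box b = S.box a := fun a => (T.mem_iff _).1 (S.box_mem a)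
  choose f hf using hex
  have hinj : Function.Injective f := fun a b hab => S.box_injective (by rw [← hf, hab, hf])
  let g : Equiv.Perm (Fin n) := Equiv.ofBijective f (Finite.injective_iff_bijective.1 hinj)
  have hg : ∀ a, T.box (g a) = S.box a := hf
  have himg : ∀ a, ∃ b, g b = a := g.surjective
  have hR : T.firstRow = S.firstRow.image g := by
    ext a
    obtain ⟨b, rfl⟩ := himg a
    simp [hg]
  have hC : T.firstCol = S.firstCol.image g := by
    ext a
    obtain ⟨b, rfl⟩ := himg a
    simp [hg]
  rw [central, central, T.symmetrizer_eq h, S.symmetrizer_eq h, hR, hC, ← conj_sym_mul_alt,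
    centralIdem_conj]

lemma unit_mul_central (h : IsHook μ) (T S : SYT n μ) : T.unit * S.central = T.unit := by
  rw [S.central_eq h T]
  have hX := (T.isPrimitive_symmetrizer h).mul_centralIdem
  change _ * T.central = _ at hX
  match n, T with
  | 0, T =>
    rw [T.symmetrizer_zero] at hX
    rwa [SYT.unit]
  | n + 1, T =>
    rw [T.unit_succ, smul_mul_assoc, mul_assoc, central, centralIdem_comm, ← central,
      ← mul_assoc, mul_assoc _ _ T.central, hX]

/-- The units of the tableaux of one hook shape sum up to the central idempotent of this shape:
the difference is an idempotent with identity coefficient `0`. -/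
lemma sum_unit (h : IsHook μ) (T : SYT n μ) : ∑ S : SYT n μ, S.unit = T.central := by
  classical
  have hp := T.isPrimitive_symmetrizer h
  set E := ∑ S : SYT n μ, S.unit with hE
  have hEE : E * E = E := by
    rw [hE, Finset.sum_mul_sum]
    refine Finset.sum_congr rfl fun S _ => ?_
    rw [Finset.sum_eq_single_of_mem S (Finset.mem_univ _), S.unit_mul_self h]
    exact fun S' _ hne => unit_mul_unit_of_ne h h S S' fun hb => hne (SYT.ext hb.symm)
  have hEz : E * T.central = E := by
    rw [hE, Finset.sum_mul]
    exact Finset.sum_congr rfl fun S _ => unit_mul_central h S T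
  have hzE : T.central * E = E := by
    rw [central, ← centralIdem_comm]; exact hEz
  have hzz : T.central * T.central = T.central := hp.centralIdem_mul_self
  have hidem : (T.central - E) * (T.central - E) = T.central - E := by
    rw [sub_mul, mul_sub, mul_sub, hEE, hEz, hzE, hzz, sub_self, sub_zero]
  have htr : tr (T.central - E) = 0 := by
    have hz : tr T.central = _ := hp.tr_centralIdem
    have hcard : (Fintype.card (SYT n μ) : ℂ) = numSYT μ := by
      rw [← card_eq_numSYT T.card_eq, Nat.card_eq_fintype_card]
    have hd : (numSYT μ : ℂ) ≠ 0 := Nat.cast_ne_zero.2 T.numSYT_ne_zero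
    have hn : (n.factorial : ℂ) ≠ 0 := Nat.cast_ne_zero.2 n.factorial_ne_zero
    rw [map_sub, hz, hE, map_sum, Finset.sum_congr rfl fun S _ => S.tr_unit h,
      Finset.sum_const, Finset.card_univ, nsmul_eq_mul, hcard, Fintype.card_perm,
      Fintype.card_fin]
    field_simp
    ring
  exact (sub_eq_zero.1 (eq_zero_of_idempotent_of_tr hidem htr)).symm

lemma unit_mul_central_of_eq (hμ : IsHook μ) (hμν : μ = ν) (T : SYT n μ) (S : SYT n ν) :
    T.unit * S.central = T.unit := by
  subst hμν
  exact unit_mul_central hμ T S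

lemma unit_mul_central_of_ne (hμ : IsHook μ) (hν : IsHook ν) (hμν : μ ≠ ν) (T : SYT n μ)
    (S : SYT n ν) : T.unit * S.central = 0 := by
  rw [← S.sum_unit hν, Finset.mul_sum]
  refine Finset.sum_eq_zero fun S' _ => unit_mul_unit_of_ne hμ hν T S' fun hb => hμν ?_
  exact diagram_ext fun c => by rw [T.mem_iff, S'.mem_iff, hb]

lemma lastInRow_iff_deleteShape {i : ℕ} {T S : SYT (n + 1) μ} (hS : S.LastInRow i) :
    T.LastInRow i ↔ T.deleteShape = S.deleteShape := by
  constructor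
  · intro hT
    exact diagram_ext fun c => by
      rw [mem_deleteShape, mem_deleteShape, last_eq_of_lastInRow hT hS]
  · intro h
    have hmem : T.box (Fin.last n) ∉ S.deleteShape := by
      rw [← h, mem_deleteShape]; simp
    have heq : T.box (Fin.last n) = S.box (Fin.last n) := by
      by_contra hne
      exact hmem (mem_deleteShape.2 ⟨T.box_mem _, hne⟩)
    rw [lastInRow_iff, heq, ← lastInRow_iff]
    exact hS

open Classical in
/-- `Γ` is the product of a central idempotent of the group algebra and a central idempotent of
the smaller group algebra; hence it commutes with the latter. -/
lemma sum_lastInRow_comm (h : IsHook μ) (i : ℕ) (x : GroupAlg n) :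
    inclusion n x * (∑ T : SYT (n + 1) μ with T.LastInRow i, T.unit) =
      (∑ T : SYT (n + 1) μ with T.LastInRow i, T.unit) * inclusion n x := by
  by_cases hex : ∃ S : SYT (n + 1) μ, S.LastInRow i
  · obtain ⟨S, hS⟩ := hex
    have hprod : ∑ T : SYT (n + 1) μ with T.LastInRow i, T.unit =
        S.central * inclusion n S.delete.central := by
      rw [← S.sum_unit h, Finset.sum_mul, Finset.sum_filter]
      refine Finset.sum_congr rfl fun T _ => ?_
      rw [← T.unit_mul_inclusion h, mul_assoc, ← map_mul]
      split_ifs with hT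
      · rw [unit_mul_central_of_eq (T.isHook_deleteShape h)
          ((lastInRow_iff_deleteShape hS).1 hT)]
      · rw [unit_mul_central_of_ne (T.isHook_deleteShape h) (S.isHook_deleteShape h)
          fun e => hT ((lastInRow_iff_deleteShape hS).2 e)]
        simp
    rw [hprod, ← mul_assoc, central, centralIdem_comm, mul_assoc, mul_assoc, ← map_mul, ← map_mul,
      central, centralIdem_comm]
  · push Not at hex
    rw [Finset.sum_eq_zero fun T hT => absurd (Finset.mem_filter.1 hT).2 (hex T)]
    simp

/-- The content (column minus row) of the box of the last label, which is the end of the arm or of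
the leg. -/
def lastContent (T : SYT (n + 1) μ) : ℂ :=
  if (T.box (Fin.last n)).1 = 0 then (T.firstRow.card : ℂ) - 1 else 1 - (T.firstCol.card : ℂ)

lemma jucysMurphy_mul_unit (h : IsHook μ) (T : SYT (n + 1) μ) :
    jucysMurphy n * T.unit = T.lastContent • T.unit := by
  have hsum := (T.isCross h).choose_spec.card_add
  rw [Fintype.card_fin] at hsum
  have hr := T.one_le_card_firstRow h
  have hc := T.one_le_card_firstCol h
  match n, T with
  | 0, T =>
    have hr1 : T.firstRow.card = 1 := by omega
    have hc1 : T.firstCol.card = 1 := by omega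
    simp [jucysMurphy, lastContent, hr1, hc1]
  | n + 1, T =>
    have h1 := T.transSum_mul_unit h
    have h2 : inclusion (n + 1) (transSum (Fin (n + 1))) * T.unit =
        (((n : ℂ) + 1) * (2 * T.delete.firstRow.card - (n + 1))) • T.unit := by
      rw [← T.inclusion_mul_unit h, ← mul_assoc, ← map_mul,
        T.delete.transSum_mul_unit (T.isHook_deleteShape h), inclusion_smul, smul_mul_assoc]
    rw [transSum_succ, add_mul, add_mul, h2, one_mul, smul_mul_assoc] at h1
    have hsum' : (T.firstRow.card : ℂ) + T.firstCol.card = n + 1 + 1 + 1 := by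
      exact_mod_cast hsum
    have hrow := T.card_firstRow_succ
    have h3 : (2 : ℂ) • (jucysMurphy (n + 1) * T.unit) = (2 : ℂ) • (T.lastContent • T.unit) := by
      have h4 : (2 : ℂ) • (jucysMurphy (n + 1) * T.unit) =
          ((((n + 1 : ℕ) : ℂ) + 1) * (2 * T.firstRow.card - (((n + 1 : ℕ) : ℂ) + 1)) -
            ((n : ℂ) + 1) * (2 * T.delete.firstRow.card - (n + 1)) - 1) • T.unit := by
        rw [sub_smul, sub_smul, one_smul, ← h1]
        abel
      rw [h4, smul_smul]
      congr 1
      unfold lastContent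
      rw [eq_sub_of_add_eq' hsum']
      split_ifs at hrow ⊢
      · rw [hrow]; push_cast; ring
      · rw [hrow]; push_cast; ring
    have := congrArg ((2 : ℂ)⁻¹ • ·) h3
    simpa [smul_smul] using this

end SYT

/-! ### The generating element of the cycle numbers -/

section Cycles

open Equiv

variable {α : Type*} [Fintype α] [DecidableEq α]

/-- The number of cycles of a permutation, fixed points included. -/
def numCycles (π : Perm α) : ℕ := π.partition.parts.card

lemma numCycles_add (π : Perm α) :
    numCycles π + π.cycleType.sum = π.cycleType.card + Fintype.card α := by
  have h : π.support.card ≤ Fintype.card α := Finset.card_le_univ _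
  rw [numCycles, Perm.parts_partition, Multiset.card_add, Multiset.card_replicate,
    Perm.sum_cycleType]
  omega

lemma numCycles_inv (π : Perm α) : numCycles π⁻¹ = numCycles π := by
  have h1 := numCycles_add π
  have h2 := numCycles_add π⁻¹
  rw [Perm.cycleType_inv] at h2
  omega

/-- Removing a moved element from its cycle makes it an additional fixed point. -/
lemma numCycles_swap_mul {g : Perm α} {z : α} (hz : g z ≠ z) :
    numCycles (swap z (g z) * g) = numCycles g + 1 := by
  set c := g.cycleOf z with hc
  set r := c⁻¹ * g with hr
  have hcyc : c.IsCycle := Perm.isCycle_cycleOf g hz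
  have hmem : c ∈ g.cycleFactorsFinset := Perm.cycleOf_mem_cycleFactorsFinset_iff.2
    (Perm.mem_support.2 hz)
  have hdis : c.Disjoint r := by
    have h := Perm.disjoint_mul_inv_of_mem_cycleFactorsFinset hmem
    have hcomm : g * c⁻¹ = c⁻¹ * g :=
      ((Perm.self_mem_cycle_factors_commute hmem).inv_left).eq.symm
    rw [hr, ← hcomm]
    exact h.symm
  have hg : g = c * r := by rw [hr, mul_inv_cancel_left]
  have hcz : c z = g z := Perm.cycleOf_apply_self g z
  have hczz : c z ≠ z := by rwa [hcz]
  have hgt : g.cycleType = {c.support.card} + r.cycleType := by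
    conv_lhs => rw [hg]
    rw [hdis.cycleType_mul, hcyc.cycleType]
  have h1 := numCycles_add g
  have h2 := numCycles_add (swap z (g z) * g)
  have hf : swap z (g z) * g = swap z (c z) * c * r := by
    rw [mul_assoc, ← hg, hcz]
  by_cases hcc : c (c z) = z
  · have hsw : c = swap z (c z) := hcyc.eq_swap_of_apply_apply_eq_self hczz hcc
    have hf1 : swap z (g z) * g = r := by
      rw [hf]
      conv_lhs => enter [1, 2]; rw [hsw]
      rw [swap_mul_self, one_mul]
    have hcard : c.support.card = 2 := by
      rw [hsw]; exact Perm.card_support_swap hczz.symm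
    rw [hgt, hcard] at h1
    rw [hf1] at h2 ⊢
    simp only [Multiset.sum_add, Multiset.card_add, Multiset.sum_singleton,
      Multiset.card_singleton] at h1
    omega
  · have hcyc' := hcyc.swap_mul hczz hcc
    have hsupp : (swap z (c z) * c).support = c.support \ {z} :=
      Perm.support_swap_mul_eq c z hcc
    have hcard : (swap z (c z) * c).support.card + 1 = c.support.card := by
      rw [hsupp, ← Finset.erase_eq]
      exact Finset.card_erase_add_one (Perm.mem_support.2 hczz)
    have hdis' : (swap z (c z) * c).Disjoint r := by
      rw [Perm.disjoint_iff_disjoint_support] at hdis ⊢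
      rw [hsupp]
      exact hdis.mono_left Finset.sdiff_subset
    rw [hgt] at h1
    rw [hf, hdis'.cycleType_mul, hcyc'.cycleType] at h2
    rw [hf]
    simp only [Multiset.sum_add, Multiset.card_add, Multiset.sum_singleton,
      Multiset.card_singleton] at h1 h2
    omega

variable {n : ℕ}

lemma numCycles_up (π : Perm (Fin n)) : numCycles (up π) = numCycles π + 1 := by
  have ht : (up π).cycleType = π.cycleType := by
    classical
    convert Perm.cycleType_extendDomain
      (Equiv.ofInjective _ (Fin.castSucc_injective n)) (g := π)
    unfold up Perm.viaEmbeddingHom Perm.extendDomainHom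
    simp only [MonoidHom.coe_mk, OneHom.coe_mk]
    congr!
  have h1 := numCycles_add π
  have h2 := numCycles_add (up π)
  rw [ht, Fintype.card_fin] at h2
  rw [Fintype.card_fin] at h1
  omega

lemma numCycles_swap_mul_up (π : Perm (Fin n)) (a : Fin n) :
    numCycles (swap a.castSucc (Fin.last n) * up π) = numCycles π := by
  have hz : (swap a.castSucc (Fin.last n) * up π) (Fin.last n) = a.castSucc := by
    rw [Perm.mul_apply, up_last, swap_apply_right]
  have h := numCycles_swap_mul (g := swap a.castSucc (Fin.last n) * up π) (z := Fin.last n)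
    (by rw [hz]; exact (Fin.castSucc_lt_last a).ne)
  rw [hz, ← mul_assoc, swap_comm (Fin.last n), swap_mul_self, one_mul, numCycles_up] at h
  omega

/-- The sum of all permutations `π` with weights `t ^ c`, where `c` is the number of cycles. -/
def cycleSum (n : ℕ) (t : ℂ) : GroupAlg n :=
  ∑ π : Perm (Fin n), MonoidAlgebra.single π (t ^ numCycles π)

lemma bijective_swap_mul_up : Function.Bijective
    fun z : Fin (n + 1) × Perm (Fin n) => swap z.1 (Fin.last n) * up z.2 := by
  constructor
  · rintro ⟨b, π⟩ ⟨b', π'⟩ h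
    simp only at h
    have hb : b = b' := by
      have := congrArg (fun w : Perm (Fin (n + 1)) => w (Fin.last n)) h
      simpa using this
    subst hb
    rw [up_injective (mul_left_cancel h)]
  · intro w
    obtain ⟨π, hπ⟩ := exists_up_eq (w := swap (w (Fin.last n)) (Fin.last n) * w) (by simp)
    refine ⟨(w (Fin.last n), π), ?_⟩
    simp only
    rw [hπ, ← mul_assoc, swap_mul_self, one_mul]

/-- Jucys' factorization of the generating element, one factor at a time. -/
lemma cycleSum_succ (n : ℕ) (t : ℂ) :
    cycleSum (n + 1) t = (t • 1 + jucysMurphy n) * inclusion n (cycleSum n t) := by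
  unfold cycleSum jucysMurphy
  rw [← bijective_swap_mul_up.sum_comp, Fintype.sum_prod_type, Fin.sum_univ_castSucc, add_mul,
    map_sum, add_comm (t • 1 * _)]
  congr 1
  · rw [Finset.sum_mul_sum]
    refine Finset.sum_congr rfl fun a _ => Finset.sum_congr rfl fun π _ => ?_
    rw [numCycles_swap_mul_up, inclusion_single, MonoidAlgebra.single_mul_single, one_mul]
  · rw [smul_mul_assoc, one_mul, Finset.smul_sum]
    refine Finset.sum_congr rfl fun π _ => ?_
    rw [swap_self, ← Perm.one_def, one_mul, numCycles_up, inclusion_single,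
      MonoidAlgebra.smul_single, smul_eq_mul, pow_succ']

/-- The product of `t + c` over the contents `c` of a hook with `r` boxes in the first row and
`c` boxes in the first column. -/
def contentProd (r c : ℕ) (t : ℂ) : ℂ :=
  (∏ j ∈ Finset.range r, (t + j)) * ∏ i ∈ Finset.range (c - 1), (t - (i + 1))

lemma SYT.cycleSum_mul_unit {μ : YoungDiagram} (h : IsHook μ) (T : SYT n μ) (t : ℂ) :
    cycleSum n t * T.unit = contentProd T.firstRow.card T.firstCol.card t • T.unit := by
  induction n generalizing μ with
  | zero =>
    have h0 : ∀ s : Finset (Fin 0), s.card = 0 := fun s => by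
      rw [Subsingleton.elim s ∅, Finset.card_empty]
    have hN : numCycles (1 : Perm (Fin 0)) = 0 := by
      have := numCycles_add (1 : Perm (Fin 0))
      simpa using this
    have hC : cycleSum 0 t = 1 := by
      unfold cycleSum
      rw [Fintype.sum_eq_single 1 fun π hπ => absurd (Subsingleton.elim π 1) hπ, hN, pow_zero,
        MonoidAlgebra.one_def]
    rw [hC, h0, h0]
    simp [contentProd]
  | succ n ih =>
    have ih' := ih (T.isHook_deleteShape h) T.delete
    have h1 : cycleSum (n + 1) t * T.unit =
        ((t + T.lastContent) *
          contentProd T.delete.firstRow.card T.delete.firstCol.card t) • T.unit := by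
      rw [cycleSum_succ, mul_assoc, ← T.inclusion_mul_unit h, ← mul_assoc (inclusion n _),
        ← map_mul, ih', inclusion_smul, smul_mul_assoc, T.inclusion_mul_unit h, mul_smul_comm,
        add_mul, smul_mul_assoc, one_mul, T.jucysMurphy_mul_unit h, ← add_smul, smul_smul,
        mul_comm]
    rw [h1]
    congr 1
    have hrow := T.card_firstRow_succ
    have hcol := T.card_firstCol_succ
    have hsum := (T.isCross h).choose_spec.card_add
    rw [Fintype.card_fin] at hsum
    have hr := T.one_le_card_firstRow h
    have hc := T.one_le_card_firstCol h
    unfold SYT.lastContent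
    rcases n with _ | n
    · have h0 : ∀ s : Finset (Fin 0), s.card = 0 := fun s => by
        rw [Subsingleton.elim s ∅, Finset.card_empty]
      have hr1 : T.firstRow.card = 1 := by omega
      have hc1 : T.firstCol.card = 1 := by omega
      rw [hr1, hc1, h0, h0]
      simp [contentProd]
    · have hsum' := (T.delete.isCross (T.isHook_deleteShape h)).choose_spec.card_add
      rw [Fintype.card_fin] at hsum'
      have hc' := T.delete.one_le_card_firstCol (T.isHook_deleteShape h)
      unfold contentProd
      by_cases hlast : (T.box (Fin.last (n + 1))).1 = 0
      · rw [if_pos hlast] at hrow ⊢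
        have hcol' : T.firstCol.card = T.delete.firstCol.card := by omega
        rw [hcol', hrow, Finset.prod_range_succ]
        push_cast
        ring
      · rw [if_neg hlast] at hrow ⊢
        obtain ⟨c, hcc⟩ := Nat.exists_eq_add_of_le' hc'
        have hcol' : T.firstCol.card = c + 1 + 1 := by omega
        rw [hcol', hrow, hcc, add_zero, Nat.add_sub_cancel, Nat.add_sub_cancel,
          Finset.prod_range_succ]
        push_cast
        ring

end Cycles

/-! ### Conjugacy under the permutations that fix one label -/

section Classes

open Equiv

variable {α : Type*} [Fintype α] [DecidableEq α]

lemma minimalPeriod_eq_card_support {σ : Perm α} {x : α} (hx : σ x ≠ x) :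
    Function.minimalPeriod σ x = (σ.cycleOf x).support.card := by
  have hc : (σ.cycleOf x).IsCycle := Perm.isCycle_cycleOf σ hx
  have hcx : (σ.cycleOf x) x ≠ x := by rwa [Perm.cycleOf_apply_self]
  rw [← hc.orderOf]
  have key : ∀ k, (σ.cycleOf x) ^ k = 1 ↔ (σ ^ k) x = x := by
    intro k
    rw [hc.pow_eq_one_iff' hcx, Perm.cycleOf_pow_apply_self]
  refine Nat.dvd_antisymm ?_ ?_
  · refine Function.IsPeriodicPt.minimalPeriod_dvd ?_
    have := (key _).1 (pow_orderOf_eq_one (σ.cycleOf x))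
    rwa [← Perm.iterate_eq_pow] at this
  · refine orderOf_dvd_of_pow_eq_one ((key _).2 ?_)
    rw [← Perm.iterate_eq_pow]
    exact Function.isPeriodicPt_minimalPeriod σ x

lemma minimalPeriod_mem_parts (σ : Perm α) (x : α) :
    Function.minimalPeriod σ x ∈ σ.partition.parts := by
  rw [Perm.parts_partition, Multiset.mem_add]
  by_cases hx : σ x = x
  · right
    rw [Function.minimalPeriod_eq_one_iff_isFixedPt.2 hx, Multiset.mem_replicate]
    have : σ.support.card < Fintype.card α :=
      Finset.card_lt_univ_of_notMem (x := x) (by simpa using hx)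
    exact ⟨by omega, rfl⟩
  · left
    rw [minimalPeriod_eq_card_support hx, Perm.cycleType_def]
    exact Multiset.mem_map_of_mem (Finset.card ∘ Perm.support)
      (Perm.cycleOf_mem_cycleFactorsFinset_iff.2 (Perm.mem_support.2 hx))

/-- The centralizer of `σ` permutes transitively the elements on cycles of one length. -/
lemma exists_commute_apply_eq (σ : Perm α) {x a : α}
    (h : Function.minimalPeriod σ x = Function.minimalPeriod σ a) :
    ∃ g : Perm α, g * σ = σ * g ∧ g x = a := by
  by_cases ha : σ a = a
  · have hx : σ x = x := by
      rw [Function.minimalPeriod_eq_one_iff_isFixedPt.2 ha] at h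
      exact Function.minimalPeriod_eq_one_iff_isFixedPt.1 h
    refine ⟨swap x a, ?_, swap_apply_left x a⟩
    have h1 := Equiv.swap_apply_apply σ x a
    rw [hx, ha] at h1
    conv_lhs => rw [h1]
    group
  · have hx : σ x ≠ x := fun hx => ha (by
      rw [Function.minimalPeriod_eq_one_iff_isFixedPt.2 hx] at h
      exact Function.minimalPeriod_eq_one_iff_isFixedPt.1 h.symm)
    let c : σ.cycleFactorsFinset := ⟨σ.cycleOf x,
      Perm.cycleOf_mem_cycleFactorsFinset_iff.2 (Perm.mem_support.2 hx)⟩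
    let d : σ.cycleFactorsFinset := ⟨σ.cycleOf a,
      Perm.cycleOf_mem_cycleFactorsFinset_iff.2 (Perm.mem_support.2 ha)⟩
    have hcd : (c : Perm α).support.card = (d : Perm α).support.card := by
      rw [← minimalPeriod_eq_card_support hx, ← minimalPeriod_eq_card_support ha, h]
    have hτ : swap c d ∈ (Perm.OnCycleFactors.toPermHom σ).range := by
      rw [Perm.OnCycleFactors.mem_range_toPermHom_iff]
      intro e
      by_cases hec : e = c
      · rw [hec, swap_apply_left, hcd]
      by_cases hed : e = d
      · rw [hed, swap_apply_right, hcd]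
      rw [swap_apply_of_ne_of_ne hec hed]
    obtain ⟨k, hk⟩ := hτ
    have hkcomm : (k : Perm α) * σ = σ * k := (Subgroup.mem_centralizer_singleton_iff.1 k.2)
    have hkc : (k : Perm α) * c * (k : Perm α)⁻¹ = d := by
      rw [← Perm.OnCycleFactors.coe_toPermHom, hk, swap_apply_left]
    have hmem : (k : Perm α) x ∈ (d : Perm α).support := by
      rw [← hkc, Perm.support_conj, Finset.mem_map_equiv]
      simpa [c] using hx
    have hsame : σ.SameCycle a ((k : Perm α) x) := (Perm.mem_support_cycleOf_iff.1 hmem).1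
    obtain ⟨i, hi⟩ := hsame.symm
    refine ⟨σ ^ i * k, ?_, hi⟩
    rw [mul_assoc, hkcomm, ← mul_assoc, ← mul_assoc, (Commute.self_zpow σ i).eq]

lemma exists_conj_fixing {π σ : Perm α} {a : α} (h : π.partition = σ.partition)
    (hp : Function.minimalPeriod π a = Function.minimalPeriod σ a) :
    ∃ g : Perm α, g a = a ∧ g * π * g⁻¹ = σ := by
  obtain ⟨g, hg⟩ := isConj_iff.1 (Perm.partition_eq_of_isConj.2 h)
  have hgk : ∀ k, (σ ^ k) (g a) = g ((π ^ k) a) := by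
    intro k
    rw [← hg, conj_pow]
    simp
  have hper : Function.minimalPeriod σ (g a) = Function.minimalPeriod π a := by
    refine Nat.dvd_antisymm ?_ ?_
    · refine Function.IsPeriodicPt.minimalPeriod_dvd ?_
      have := Function.isPeriodicPt_minimalPeriod π a
      rw [Function.IsPeriodicPt, Function.IsFixedPt, Perm.iterate_eq_pow] at this ⊢
      rw [hgk, this]
    · refine Function.IsPeriodicPt.minimalPeriod_dvd ?_
      have := Function.isPeriodicPt_minimalPeriod σ (g a)
      rw [Function.IsPeriodicPt, Function.IsFixedPt, Perm.iterate_eq_pow] at this ⊢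
      rw [hgk] at this
      exact g.injective this
  obtain ⟨k, hk, hka⟩ := exists_commute_apply_eq σ (hper.trans hp)
  refine ⟨k * g, hka, ?_⟩
  have : k * g * π * (k * g)⁻¹ = k * (g * π * g⁻¹) * k⁻¹ := by group
  rw [this, hg, hk, mul_inv_cancel_right]

end Classes

/-! ### Coordinates with respect to the classes -/

section Coordinates

open Equiv

variable {n : ℕ}

/-- The cycle type of a permutation of `n` labels, as a partition of `n`. -/
def typeOf (π : Perm (Fin n)) : n.Partition where
  parts := π.partition.parts
  parts_pos := π.partition.parts_pos
  parts_sum := π.partition.parts_sum.trans (Fintype.card_fin n)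

/-- The length of the cycle of the largest label. -/
def lastPeriod (π : Perm (Fin (n + 1))) : ℕ := Function.minimalPeriod π (Fin.last n)

lemma lastPeriod_mem (π : Perm (Fin (n + 1))) : lastPeriod π ∈ (typeOf π).parts :=
  minimalPeriod_mem_parts π _

lemma mem_cls {lam : (n + 1).Partition} {i : ℕ} {π : Perm (Fin (n + 1))} :
    π ∈ cls lam i ↔ lam = typeOf π ∧ i = lastPeriod π := by
  rw [cls, Finset.mem_filter, Nat.Partition.ext_iff]
  constructor
  · rintro ⟨-, h1, a, ha, h2⟩
    obtain rfl : a = Fin.last n := Fin.ext (by simpa using ha)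
    exact ⟨h1.symm, h2.symm⟩
  · rintro ⟨h1, h2⟩
    exact ⟨Finset.mem_univ _, h1.symm, Fin.last n, rfl, h2.symm⟩

open Classical in
/-- Every permutation lies in exactly one class `𝒞_{λ,i}` with `i ∈ λ`. -/
lemma sum_cls_ite {M : Type*} [AddCommMonoid M] (π : Perm (Fin (n + 1)))
    (f : (n + 1).Partition → ℕ → M) :
    ∑ lam : (n + 1).Partition, ∑ i ∈ lam.parts.toFinset, (if π ∈ cls lam i then f lam i else 0) =
      f (typeOf π) (lastPeriod π) := by
  rw [Finset.sum_eq_single_of_mem (typeOf π) (Finset.mem_univ _),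
    Finset.sum_eq_single_of_mem (lastPeriod π) (Multiset.mem_toFinset.2 (lastPeriod_mem π)),
    if_pos (mem_cls.2 ⟨rfl, rfl⟩)]
  · exact fun i _ hi => if_neg fun h => hi (mem_cls.1 h).2
  · exact fun lam _ hlam => Finset.sum_eq_zero fun i _ => if_neg fun h => hlam (mem_cls.1 h).1

lemma coeff_sum_smul_K (c : (n + 1).Partition → ℕ → ℂ) (π : Perm (Fin (n + 1))) :
    (∑ mu : (n + 1).Partition, ∑ j ∈ mu.parts.toFinset, c mu j • K mu j).coeff π =
      c (typeOf π) (lastPeriod π) := by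
  classical
  rw [← sum_cls_ite π c, MonoidAlgebra.coeff_sum, Finsupp.finsetSum_apply]
  refine Finset.sum_congr rfl fun mu _ => ?_
  rw [MonoidAlgebra.coeff_sum, Finsupp.finsetSum_apply]
  refine Finset.sum_congr rfl fun j _ => ?_
  rw [MonoidAlgebra.coeff_smul_apply, K, MonoidAlgebra.coeff_sum, Finsupp.finsetSum_apply]
  simp [Finsupp.single_apply]

/-- An element that commutes with the smaller group algebra has coordinates with respect to the
`K_{λ,i}`. -/
lemma exists_isCoord {x : GroupAlg (n + 1)}
    (hx : ∀ y : GroupAlg n, inclusion n y * x = x * inclusion n y) :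
    ∃ c, IsCoord x c := by
  classical
  have hconst : ∀ π σ : Perm (Fin (n + 1)), typeOf π = typeOf σ → lastPeriod π = lastPeriod σ →
      x.coeff π = x.coeff σ := by
    intro π σ ht hp
    have hpart : π.partition = σ.partition :=
      Nat.Partition.ext (congrArg (fun p : (n + 1).Partition => p.parts) ht)
    obtain ⟨g, hg, hgπ⟩ := exists_conj_fixing hpart hp
    obtain ⟨g', rfl⟩ := exists_up_eq hg
    have h := congrArg (fun y => y.coeff (up g' * π)) (hx (MonoidAlgebra.single g' 1))
    simp only [inclusion_single, MonoidAlgebra.coeff_single_mul_apply,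
      MonoidAlgebra.coeff_mul_single_apply, one_mul, mul_one, inv_mul_cancel_left] at h
    rw [h, hgπ]
  refine ⟨fun mu j => if h : (cls mu j).Nonempty then x.coeff h.choose else 0, ?_⟩
  refine MonoidAlgebra.coeff_injective (Finsupp.ext fun π => ?_)
  have hne : (cls (typeOf π) (lastPeriod π)).Nonempty := ⟨π, mem_cls.2 ⟨rfl, rfl⟩⟩
  rw [coeff_sum_smul_K, dif_pos hne]
  have hmem := mem_cls.1 hne.choose_spec
  exact hconst _ _ hmem.1 hmem.2

lemma card_mul_coeffK {x : GroupAlg (n + 1)} (hx : ∃ c, IsCoord x c)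
    (lam : (n + 1).Partition) (i : ℕ) :
    ((cls lam i).card : ℂ) * coeffK lam i x = ∑ π ∈ cls lam i, x.coeff π := by
  classical
  rw [coeffK, dif_pos hx]
  have hc : IsCoord x hx.choose := hx.choose_spec
  rw [← nsmul_eq_mul, ← Finset.sum_const]
  refine Finset.sum_congr rfl fun π hπ => ?_
  obtain ⟨rfl, rfl⟩ := mem_cls.1 hπ
  conv_rhs => rw [hc, coeff_sum_smul_K]

lemma sum_cls_eq_sum_numCycles (m : ℕ) (f : Perm (Fin (n + 1)) → ℂ) :
    ∑ lam : (n + 1).Partition with lam.parts.card = m, ∑ i ∈ lam.parts.toFinset,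
      ∑ π ∈ cls lam i, f π = ∑ π : Perm (Fin (n + 1)), if numCycles π = m then f π else 0 := by
  classical
  have h : ∀ π : Perm (Fin (n + 1)), (if numCycles π = m then f π else 0) =
      ∑ lam : (n + 1).Partition, ∑ i ∈ lam.parts.toFinset,
        if π ∈ cls lam i then (if lam.parts.card = m then f π else 0) else 0 := fun π =>
    (sum_cls_ite π fun lam _ => if lam.parts.card = m then f π else 0).symm
  rw [Finset.sum_congr rfl fun π _ => h π, Finset.sum_comm, Finset.sum_filter]
  refine Finset.sum_congr rfl fun lam _ => ?_
  rw [Finset.sum_comm]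
  split_ifs
  · refine Finset.sum_congr rfl fun i _ => ?_
    rw [← Finset.sum_filter]
    exact Finset.sum_congr (by ext; simp) fun _ _ => rfl
  · simp

end Coordinates

/-! ### Hook partitions -/

section HookPartitions

lemma ferrers_eq_hookDiagram {n a b : ℕ} (lam : n.Partition)
    (h : lam.parts = (a + 1) ::ₘ Multiset.replicate b 1) : ferrers lam = hookDiagram a b := by
  have hsort : lam.parts.sort (· ≥ ·) = (a + 1) :: List.replicate b 1 := by
    rw [h, Multiset.sort_cons]
    · congr 1
      rw [List.eq_replicate_iff]
      refine ⟨by simp, fun x hx => ?_⟩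
      exact Multiset.eq_of_mem_replicate ((Multiset.mem_sort _).1 hx)
    · intro x hx
      rw [Multiset.eq_of_mem_replicate hx]
      omega
  refine diagram_ext fun c => ?_
  obtain ⟨i, j⟩ := c
  rw [ferrers, YoungDiagram.mem_ofRowLens, mem_hookDiagram]
  simp only [hsort]
  cases i with
  | zero => simp; omega
  | succ i => simp; omega

lemma ferrers_hook {n k : ℕ} (hk : k < n) : ferrers (hook n k hk) = hookDiagram (n - k - 1) k :=
  ferrers_eq_hookDiagram _ (by rw [hook, Nat.sub_add_cancel (by omega)])

lemma ferrers_zero (lam : Nat.Partition 0) : ferrers lam = ⊥ := by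
  refine diagram_ext fun c => ?_
  rw [ferrers, YoungDiagram.mem_ofRowLens]
  simp

lemma lower_parts {n : ℕ} (lam : n.Partition) (i : ℕ) (hi : i ∈ lam.parts) :
    (lower lam i hi).parts = ((i - 1) ::ₘ lam.parts.erase i).filter (· ≠ 0) := rfl

lemma filter_ne_zero_replicate (k : ℕ) :
    (Multiset.replicate k 1).filter (· ≠ 0) = Multiset.replicate k 1 :=
  Multiset.filter_eq_self.2 fun x hx => by rw [Multiset.eq_of_mem_replicate hx]; exact one_ne_zero

lemma card_SYT_hookDiagram {n a b : ℕ} (h : a + b = n) :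
    Nat.card (SYT (n + 1) (hookDiagram a b)) = numSYT (hookDiagram a b) ∧
      numSYT (hookDiagram a b) ≠ 0 := by
  have hcard := SYT.card_hookDiagram n a b h
  have hpos : 0 < Nat.card (SYT (n + 1) (hookDiagram a b)) := by
    rw [hcard]; exact Nat.choose_pos (by omega)
  obtain ⟨T⟩ := (Nat.card_pos_iff.1 hpos).1
  exact ⟨SYT.card_eq_numSYT T.card_eq, T.numSYT_ne_zero⟩

/-- Lowering the part `l` of a hook removes the end of a row of length `l`, so that the tableaux
of the lowered shape `nu` correspond to the tableaux whose last label stands there. -/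
lemma card_lastInRow_hookDiagram {a k l : ℕ} (hl : l = 1 ∨ l = a + 1)
    (hmem : l ∈ (a + 1) ::ₘ Multiset.replicate k 1) (nu : (a + k).Partition)
    (hnu : nu.parts =
      ((l - 1) ::ₘ ((a + 1) ::ₘ Multiset.replicate k 1).erase l).filter (· ≠ 0)) :
    Nat.card {T : SYT (a + k + 1) (hookDiagram a k) // T.LastInRow l} = numSYT (ferrers nu) ∧
      numSYT (ferrers nu) ≠ 0 := by
  have hiff : ∀ b : ℕ × ℕ, (∀ T : SYT (a + k + 1) (hookDiagram a k),
      T.LastInRow l ↔ T.box (Fin.last (a + k)) = b) →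
      Nat.card {T : SYT (a + k + 1) (hookDiagram a k) // T.LastInRow l} =
        Nat.card {T : SYT (a + k + 1) (hookDiagram a k) // T.box (Fin.last (a + k)) = b} :=
    fun b hb => Nat.card_congr (Equiv.subtypeEquivRight hb)
  by_cases harm : l = a + 1 ∧ a ≠ 0
  · obtain ⟨rfl, ha0⟩ := harm
    obtain ⟨a, rfl⟩ := Nat.exists_eq_succ_of_ne_zero ha0
    rw [Multiset.erase_cons_head, Nat.add_sub_cancel,
      Multiset.filter_cons_of_pos _ (by simp), filter_ne_zero_replicate] at hnu
    rw [ferrers_eq_hookDiagram nu hnu, hiff (0, a + 1), SYT.card_last_arm,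
      show a.succ + k = a + k + 1 by omega]
    · exact card_SYT_hookDiagram rfl
    · intro T
      rw [SYT.lastInRow_iff]
      rcases T.last_hookDiagram with h | h
      · simp [h, rowLen_zero_hookDiagram]
      · simp [h]
  · obtain rfl : l = 1 := by omega
    match k with
    | k + 1 =>
      have herase : ((a + 1) ::ₘ Multiset.replicate (k + 1) 1).erase 1 =
          (a + 1) ::ₘ Multiset.replicate k 1 := by
        rw [Multiset.replicate_succ, Multiset.cons_swap, Multiset.erase_cons_head]
      rw [herase, Nat.sub_self, Multiset.filter_cons_of_neg _ (by simp),
        Multiset.filter_cons_of_pos _ (by simp), filter_ne_zero_replicate] at hnu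
      rw [ferrers_eq_hookDiagram nu hnu, hiff (k + 1, 0), SYT.card_last_leg,
        show a + (k + 1) = a + k + 1 by omega]
      · exact card_SYT_hookDiagram rfl
      · intro T
        rw [SYT.lastInRow_iff]
        rcases T.last_hookDiagram with h | h
        · -- If the arm is trivial, the corner cannot carry the largest label.
          have hne : a ≠ 0 := by
            rintro rfl
            have hc := T.last_corner (c := (k + 1, 0))
              (mem_hookDiagram.2 (Or.inr ⟨rfl, le_rfl⟩))
              (by rw [h]; exact Prod.le_def.2 ⟨Nat.zero_le _, le_rfl⟩)
            rw [h] at hc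
            simp at hc
          simp [h, hne]
        · simp [h, rowLen_hookDiagram]
    | 0 =>
      obtain rfl : a = 0 := by simpa [eq_comm] using hmem
      rw [ferrers_zero nu, hiff (0, 0), SYT.card_last_single, SYT.card_zero_bot]
      · rw [← SYT.card_eq_numSYT (n := 0) (μ := ⊥) rfl, SYT.card_zero_bot]
        simp
      · intro T
        have h : T.box (Fin.last (0 + 0)) = (0, 0) := T.last_hookDiagram.elim id id
        rw [SYT.lastInRow_iff, h]
        simp [rowLen_zero_hookDiagram]

end HookPartitions

/-! ### The content polynomial of a hook -/

section Evaluation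

open Polynomial

lemma eval_factorial_mul_choose (n : ℕ) (c t : ℂ) :
    ((n.factorial : ℂ[X]) * Ring.choose (X + C c) n).eval t =
      ∏ j ∈ Finset.range n, (t + c - j) := by
  rw [← nsmul_eq_mul, ← Ring.descPochhammer_eq_factorial_smul_choose, ← aeval_eq_smeval,
    aeval_def, ← eval_map, descPochhammer_map, descPochhammer_eval_eq_prod_range, eval_prod]
  simp

lemma contentProd_hook (a k : ℕ) (t : ℂ) :
    contentProd (a + 1) (k + 1) t = ∏ j ∈ Finset.range (a + k + 1), (t + a - j) := by
  rw [contentProd, Nat.add_sub_cancel, show a + k + 1 = a + 1 + k by omega,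
    Finset.prod_range_add _ (a + 1) k, ← Finset.prod_range_reflect (fun j : ℕ => t + (j : ℂ)) (a + 1)]
  congr 1
  · refine Finset.prod_congr rfl fun j hj => ?_
    have : j ≤ a := by rw [Finset.mem_range] at hj; omega
    rw [Nat.add_sub_cancel, Nat.cast_sub this]
    ring
  · refine Finset.prod_congr rfl fun j _ => ?_
    push_cast
    ring

end Evaluation

section CycleNumbers

open Polynomial Equiv

variable {n : ℕ}

lemma tr_cycleSum_mul (t : ℂ) (x : GroupAlg n) :
    tr (cycleSum n t * x) = ∑ π, x.coeff π * t ^ numCycles π := by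
  unfold cycleSum
  rw [Finset.sum_mul, map_sum, ← Equiv.sum_comp (Equiv.inv (Perm (Fin n)))]
  refine Finset.sum_congr rfl fun π _ => ?_
  rw [Equiv.inv_apply, tr_single_mul, inv_inv, numCycles_inv, mul_comm]

open Classical in
/-- The distribution of the cycle numbers in `Γ`: the coefficients of the content polynomial. -/
lemma sum_coeff_lastInRow {μ : YoungDiagram} (h : IsHook μ) (i : ℕ) (t : ℂ) {r c : ℕ}
    (hrc : ∀ T : SYT n μ, T.firstRow.card = r ∧ T.firstCol.card = c) :
    ∑ π, (∑ T : SYT n μ with T.LastInRow i, T.unit).coeff π * t ^ numCycles π =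
      Nat.card {T : SYT n μ // T.LastInRow i} * ((n.factorial : ℂ) / numSYT μ)⁻¹ *
        contentProd r c t := by
  rw [← tr_cycleSum_mul, Finset.mul_sum, map_sum]
  have hT : ∀ T : SYT n μ, tr (cycleSum n t * T.unit) =
      contentProd r c t * ((n.factorial : ℂ) / numSYT μ)⁻¹ := by
    intro T
    rw [T.cycleSum_mul_unit h, (hrc T).1, (hrc T).2, map_smul, T.tr_unit h, smul_eq_mul]
  rw [Finset.sum_congr rfl fun T _ => hT T, Finset.sum_const, nsmul_eq_mul,
    Nat.card_eq_fintype_card, Fintype.card_subtype]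
  ring

end CycleNumbers

end NearCentral

end

theorem lemma7 (n k m l : ℕ) (hk : k < n) (hl : l = 1 ∨ l = n - k)
    (hmem : l ∈ (NearCentral.hook n k hk).parts) :
    ∑ lam : n.Partition with lam.parts.card = m, ∑ i ∈ lam.parts.toFinset,
        ((NearCentral.cls lam i).card : ℂ) /
            (NearCentral.degree (NearCentral.lower (NearCentral.hook n k hk) l hmem) : ℂ) *
          NearCentral.genChar (NearCentral.hook n k hk) l lam i =
      ((n.factorial : Polynomial ℂ) *
        Ring.choose (Polynomial.X + Polynomial.C ((n : ℂ) - (k : ℂ) - 1)) n).coeff m := by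
  classical
  obtain ⟨a, rfl⟩ : ∃ a, n = a + k + 1 := ⟨n - k - 1, by omega⟩
  have hak : a + k + 1 - k = a + 1 := by omega
  have hshape : NearCentral.ferrers (NearCentral.hook (a + k + 1) k hk) =
      NearCentral.hookDiagram a k := by
    rw [NearCentral.ferrers_hook, hak, Nat.add_sub_cancel]
  have hparts : (NearCentral.hook (a + k + 1) k hk).parts =
      (a + 1) ::ₘ Multiset.replicate k 1 := by
    rw [← hak]; rfl
  have hhook := NearCentral.isHook_hookDiagram a k
  have hlow := NearCentral.lower_parts (NearCentral.hook (a + k + 1) k hk) l hmem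
  rw [hparts] at hlow
  obtain ⟨hcount, hd'⟩ := NearCentral.card_lastInRow_hookDiagram (a := a) (k := k) (l := l)
    (by rwa [hak] at hl) (by rwa [hparts] at hmem) _ hlow
  obtain ⟨-, hd⟩ := NearCentral.card_SYT_hookDiagram (n := a + k) (a := a) (b := k) rfl
  set Γ : NearCentral.GroupAlg (a + k + 1) :=
    ∑ T : NearCentral.SYT (a + k + 1) (NearCentral.hookDiagram a k) with T.LastInRow l, T.unit
    with hΓ
  have hGam : NearCentral.Gam (NearCentral.hook (a + k + 1) k hk) l = Γ := by
    rw [NearCentral.Gam, hshape]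
  have hcoord := NearCentral.exists_isCoord (x := Γ) fun y =>
    NearCentral.SYT.sum_lastInRow_comm hhook l y
  have hrc : ∀ T : NearCentral.SYT (a + k + 1) (NearCentral.hookDiagram a k),
      T.firstRow.card = a + 1 ∧ T.firstCol.card = k + 1 := by
    intro T
    have h1 := T.card_firstRow_add hhook
    have h2 := congrArg (fun μ => μ.rowLen 0) (T.eq_hookDiagram hhook)
    simp only [NearCentral.rowLen_zero_hookDiagram] at h2
    have h3 := T.one_le_card_firstRow hhook
    have h4 := T.one_le_card_firstCol hhook
    omega
  set d : ℂ := (NearCentral.numSYT (NearCentral.hookDiagram a k) : ℂ) with hdef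
  set d' : ℂ := (NearCentral.degree
    (NearCentral.lower (NearCentral.hook (a + k + 1) k hk) l hmem) : ℂ) with hdef'
  have hd0 : d ≠ 0 := Nat.cast_ne_zero.2 hd
  have hd0' : d' ≠ 0 := Nat.cast_ne_zero.2 hd'
  have hN : ((a + k + 1).factorial : ℂ) ≠ 0 := Nat.cast_ne_zero.2 (Nat.factorial_ne_zero _)
  -- The generating polynomial of the cycle numbers in `Γ`, compared at every complex number.
  have hpoly : (((a + k + 1).factorial : Polynomial ℂ) *
      Ring.choose (Polynomial.X + Polynomial.C (((a + k + 1 : ℕ) : ℂ) - (k : ℂ) - 1))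
        (a + k + 1)) = Polynomial.C (((a + k + 1).factorial : ℂ) / (d * d')) *
      ∑ π, Polynomial.C (Γ.coeff π) * Polynomial.X ^ NearCentral.numCycles π := by
    refine Polynomial.funext fun t => ?_
    rw [NearCentral.eval_factorial_mul_choose, Polynomial.eval_mul, Polynomial.eval_finsetSum]
    simp only [Polynomial.eval_mul, Polynomial.eval_C, Polynomial.eval_pow, Polynomial.eval_X]
    rw [hΓ, NearCentral.sum_coeff_lastInRow hhook l t hrc, hcount, NearCentral.contentProd_hook,
      ← hdef]
    change _ = _ * (d' * _ * _)
    have hc : ((a + k + 1 : ℕ) : ℂ) - (k : ℂ) - 1 = a := by push_cast; ring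
    rw [hc]
    field_simp
  rw [hpoly, Polynomial.coeff_C_mul, Polynomial.finsetSum_coeff]
  simp only [Polynomial.coeff_C_mul, Polynomial.coeff_X_pow, mul_ite, mul_one, mul_zero]
  have hsum := NearCentral.sum_cls_eq_sum_numCycles m fun π => Γ.coeff π
  simp only [eq_comm (a := m)]
  rw [← hsum, Finset.mul_sum]
  refine Finset.sum_congr rfl fun lam _ => ?_
  rw [Finset.mul_sum]
  refine Finset.sum_congr rfl fun i _ => ?_
  rw [← NearCentral.card_mul_coeffK hcoord, NearCentral.genChar, hGam, NearCentral.degree, hshape,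
    ← hdef]
  field_simp
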